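/- Let $k$ be a field and let $A$ be a (left and right) noetherian Hopf algebra over $k$ with comultiplication $\Delta(a)=\sum a_1\otimes a_2$, counit $\epsilon$ and bijective antipode $S$; let $k$ also denote the trivial left or right $A$-module $A/\ker\epsilon$. Suppose that $A$ is Artin–Schelter regular of global dimension $d<\infty$; that is: $A$ has injective dimension $d$ as a left module over itself, $\dim_k\operatorname{Ext}^d_A({}_Ak,{}_AA)=1$ and $\operatorname{Ext}^i_A({}_Ak,{}_AA)=0$ for all $i\neq d$; the same holds for right modules; and $A$ has global dimension $d$. The right $A$-action on the left homological integral $\int^l=\operatorname{Ext}^d_A({}_Ak,{}_AA)$, induced by right multiplication on $A$, is given by an algebra homomorphism $\pi_0\colon A\to k$, namely $x\cdot a=\pi_0(a)x$ for $x\in\int^l$, $a\in A$. Let $\xi$ be the corresponding left winding automorphism of $A$, $\xi(a)=\sum\pi_0(a_1)a_2$. For an $A$-bimodule $M$ and an algebra automorphism $\sigma$ of $A$, let ${}^{\sigma}M$ denote the bimodule $M$ with actions $a\cdot m\cdot b=\sigma(a)mb$. Let $H^i(A,M)$ and $H_i(A,M)$ denote the Hochschild cohomology and homology of the $k$-algebra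 $A$ with coefficients in $M$. Then for every $A$-bimodule $M$ (on which $k$ acts centrally) and every integer $i$ with $0\le i\le d$ there is an isomorphism of $k$-vector spaces $$H^i(A,M)\;\cong\;H_{d-i}\bigl(A,\,{}^{\xi^{-1}S^{-2}}M\bigr).$$ -/

import Mathlib

open CategoryTheory CategoryTheory.Abelian
open scoped TensorProduct

universe u

set_option linter.unusedSectionVars false

namespace HopfDuality

noncomputable section

/-! ### Hochschild cohomology and homology of an algebra with coefficients in a bimodule

An `A`-bimodule (central over `k`) is a `k`-module `M` with commuting actions of `A` and of
`Aᵐᵒᵖ`, both compatible with the action of `k`; the right action is `m * a = op a • m`. -/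

section Hochschild

variable {k A : Type*} [CommRing k] [Ring A] [Algebra k A]

/-- Replacing two neighbouring entries `a_j, a_{j+1}` of a tuple by their product commutes
with changing one entry of the tuple. -/
theorem contractNth_update {n : ℕ} (j : Fin n) (a : Fin (n + 1) → A) (i : Fin (n + 1)) :
    ∃ (p : Fin n) (l r : A), ∀ x : A,
      j.castSucc.contractNth (· * ·) (Function.update a i x) =
        Function.update (j.castSucc.contractNth (· * ·) a) p (l * x * r) := by
  rcases lt_trichotomy (i : ℕ) (j : ℕ) with h | h | h
  · refine ⟨⟨i, by omega⟩, 1, 1, fun x => ?_⟩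
    ext q
    simp only [Fin.contractNth, Function.update_apply, Fin.ext_iff, Fin.val_castSucc, Fin.val_succ,
      one_mul, mul_one]
    grind
  · refine ⟨j, 1, a j.succ, fun x => ?_⟩
    ext q
    simp only [Fin.contractNth, Function.update_apply, Fin.ext_iff, Fin.val_castSucc, Fin.val_succ,
      one_mul]
    have : (q : ℕ) = j → q = j := Fin.ext
    grind
  · by_cases h' : (i : ℕ) = j + 1
    · refine ⟨j, a j.castSucc, 1, fun x => ?_⟩
      ext q
      simp only [Fin.contractNth, Function.update_apply, Fin.ext_iff, Fin.val_castSucc,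
        Fin.val_succ, mul_one]
      have : (q : ℕ) = j → q = j := Fin.ext
      grind
    · refine ⟨⟨i - 1, by omega⟩, 1, 1, fun x => ?_⟩
      ext q
      simp only [Fin.contractNth, Function.update_apply, Fin.ext_iff, Fin.val_castSucc,
        Fin.val_succ, one_mul, mul_one]
      grind

/-- The multilinear map `(a_0, …, a_n) ↦ f (a_0, …, a_j a_{j+1}, …, a_n)`. -/
def contract {N : Type*} [AddCommGroup N] [Module k N] {n : ℕ} (j : Fin n)
    (f : MultilinearMap k (fun _ : Fin n => A) N) :
    MultilinearMap k (fun _ : Fin (n + 1) => A) N where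
  toFun a := f (j.castSucc.contractNth (· * ·) a)
  map_update_add' {inst} a i x y := by
    obtain rfl : inst = instDecidableEqFin _ := Subsingleton.elim _ _
    obtain ⟨p, l, r, h⟩ := contractNth_update j a i
    simp only [h, mul_add, add_mul, f.map_update_add]
  map_update_smul' {inst} a i c x := by
    obtain rfl : inst = instDecidableEqFin _ := Subsingleton.elim _ _
    obtain ⟨p, l, r, h⟩ := contractNth_update j a i
    simp only [h, mul_smul_comm, smul_mul_assoc, f.map_update_smul]

variable (k A) (M : Type*) [AddCommGroup M] [Module k M] [Module A M] [Module Aᵐᵒᵖ M]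
  [SMulCommClass A Aᵐᵒᵖ M] [IsScalarTower k A M] [IsScalarTower k Aᵐᵒᵖ M]

/-- Hochschild `n`-cochains: `k`-multilinear maps `A × ⋯ × A → M` in `n` variables. -/
abbrev HochschildCochain (n : ℕ) : Type _ := MultilinearMap k (fun _ : Fin n => A) M

/-- Right multiplication `a ↦ (m ↦ m a)`. -/
def rightMul : A →ₗ[k] Module.End k M :=
  (Algebra.lsmul k k M).toLinearMap ∘ₗ (MulOpposite.opLinearEquiv k (M := A)).toLinearMap

/-- Left multiplication `a ↦ (m ↦ a m)`. -/
def leftMul : A →ₗ[k] Module.End k M := (Algebra.lsmul k k M).toLinearMap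

@[simp] theorem rightMul_apply (a : A) (m : M) :
    rightMul k A M a m = MulOpposite.op a • m := rfl

@[simp] theorem leftMul_apply (a : A) (m : M) : leftMul k A M a m = a • m := rfl

/-- The Hochschild coboundary: `(δ f) (a_0, …, a_n)` is
`a_0 f (a_1, …, a_n) + ∑_{j < n} (-1)^(j+1) f (a_0, …, a_j a_{j+1}, …, a_n)`
`+ (-1)^(n+1) f (a_0, …, a_{n-1}) a_n`. -/
def hochschildCoboundary (n : ℕ) :
    HochschildCochain k A M n →ₗ[k] HochschildCochain k A M (n + 1) where
  toFun f :=
    LinearMap.uncurryLeft (M := fun _ : Fin (n + 1) => A)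
      { toFun a := (leftMul k A M a).compMultilinearMap f
        map_add' a b := by ext v; simp
        map_smul' c a := by ext v; simp }
    + ∑ j : Fin n, (-1 : k) ^ ((j : ℕ) + 1) • contract j f
    + (-1 : k) ^ (n + 1) •
      MultilinearMap.uncurryRight (M := fun _ : Fin (n + 1) => A)
        ((rightMul k A M).flip.compMultilinearMap f)
  map_add' f g := by
    ext v
    simp [contract, Finset.sum_add_distrib]
    abel
  map_smul' c f := by
    ext v
    simp [contract, Finset.smul_sum, smul_comm c]

theorem hochschildCoboundary_apply (n : ℕ) (f : HochschildCochain k A M n)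
    (a : Fin (n + 1) → A) :
    hochschildCoboundary k A M n f a =
      a 0 • f (Fin.tail a)
      + ∑ j : Fin n, (-1 : k) ^ ((j : ℕ) + 1) • f (j.castSucc.contractNth (· * ·) a)
      + (-1 : k) ^ (n + 1) • MulOpposite.op (a (Fin.last n)) • f (Fin.init a) := by
  simp [hochschildCoboundary, contract]

/-- The coboundaries in degree `n`: the image of the incoming differential. -/
def hochschildCoboundaries : (n : ℕ) → Submodule k (HochschildCochain k A M n)
  | 0 => ⊥
  | n + 1 => LinearMap.range (hochschildCoboundary k A M n)

/-- The cocycles in degree `n`: the kernel of the outgoing differential. -/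
def hochschildCocycles (n : ℕ) : Submodule k (HochschildCochain k A M n) :=
  LinearMap.ker (hochschildCoboundary k A M n)

/-- Hochschild cohomology `H^n(A, M)`: cocycles modulo coboundaries. -/
abbrev HochschildCohomology (n : ℕ) : Type _ :=
  hochschildCocycles k A M n ⧸
    (hochschildCoboundaries k A M n).submoduleOf (hochschildCocycles k A M n)

/-- Hochschild `n`-chains `M ⊗ A^{⊗ n}`. -/
abbrev HochschildChain (n : ℕ) : Type _ := M ⊗[k] (⨂[k] _ : Fin n, A)

/-- The Hochschild boundary on `m ⊗ (a_0 ⊗ ⋯ ⊗ a_n)`, as a multilinear map of the `a_j`. -/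
def hochschildBoundaryAux (n : ℕ) :
    M →ₗ[k] MultilinearMap k (fun _ : Fin (n + 1) => A) (HochschildChain k A M n) where
  toFun m :=
    LinearMap.uncurryLeft (M := fun _ : Fin (n + 1) => A)
      { toFun a := (TensorProduct.mk k M (⨂[k] _ : Fin n, A)
            (rightMul k A M a m)).compMultilinearMap (PiTensorProduct.tprod k)
        map_add' a b := by ext v; simp
        map_smul' c a := by ext v; simp [TensorProduct.smul_tmul'] }
    + ∑ j : Fin n, (-1 : k) ^ ((j : ℕ) + 1) •
        contract j ((TensorProduct.mk k M (⨂[k] _ : Fin n, A) m).compMultilinearMap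
          (PiTensorProduct.tprod k))
    + (-1 : k) ^ (n + 1) •
      MultilinearMap.uncurryRight (M := fun _ : Fin (n + 1) => A)
        ((((TensorProduct.mk k M (⨂[k] _ : Fin n, A)) ∘ₗ
          (leftMul k A M).flip m).flip).compMultilinearMap (PiTensorProduct.tprod k))
  map_add' m m' := by
    ext v
    simp [contract, Finset.sum_add_distrib]
    abel
  map_smul' c m := by
    ext v
    simp [contract, Finset.smul_sum, smul_comm c,
      TensorProduct.smul_tmul']

/-- The Hochschild boundary: `m ⊗ (a_0 ⊗ ⋯ ⊗ a_n)` is sent to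
`m a_0 ⊗ (a_1 ⊗ ⋯ ⊗ a_n) + ∑_{j < n} (-1)^(j+1) m ⊗ (a_0 ⊗ ⋯ ⊗ a_j a_{j+1} ⊗ ⋯ ⊗ a_n)`
`+ (-1)^(n+1) a_n m ⊗ (a_0 ⊗ ⋯ ⊗ a_{n-1})`. -/
def hochschildBoundary (n : ℕ) :
    HochschildChain k A M (n + 1) →ₗ[k] HochschildChain k A M n :=
  TensorProduct.lift ((PiTensorProduct.lift (R := k) (s := fun _ : Fin (n + 1) => A)).toLinearMap ∘ₗ
    hochschildBoundaryAux k A M n)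

theorem hochschildBoundary_tmul (n : ℕ) (m : M) (a : Fin (n + 1) → A) :
    hochschildBoundary k A M n (m ⊗ₜ PiTensorProduct.tprod k a) =
      (MulOpposite.op (a 0) • m) ⊗ₜ PiTensorProduct.tprod k (Fin.tail a)
      + ∑ j : Fin n, (-1 : k) ^ ((j : ℕ) + 1) •
          (m ⊗ₜ PiTensorProduct.tprod k (j.castSucc.contractNth (· * ·) a))
      + (-1 : k) ^ (n + 1) •
          ((a (Fin.last n) • m) ⊗ₜ PiTensorProduct.tprod k (Fin.init a)) := by
  simp [hochschildBoundary, hochschildBoundaryAux, contract]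

/-- The cycles in degree `n`: the kernel of the outgoing differential. -/
def hochschildCycles : (n : ℕ) → Submodule k (HochschildChain k A M n)
  | 0 => ⊤
  | n + 1 => LinearMap.ker (hochschildBoundary k A M n)

/-- The boundaries in degree `n`: the image of the incoming differential. -/
def hochschildBoundaries (n : ℕ) : Submodule k (HochschildChain k A M n) :=
  LinearMap.range (hochschildBoundary k A M n)

/-- Hochschild homology `H_n(A, M)`: cycles modulo boundaries. -/
abbrev HochschildHomology (n : ℕ) : Type _ :=
  hochschildCycles k A M n ⧸
    (hochschildBoundaries k A M n).submoduleOf (hochschildCycles k A M n)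

end Hochschild

/-! ### Twisted bimodules -/

section Twist

variable {k A : Type*} [CommRing k] [Ring A] [Algebra k A]

/-- The twisted bimodule `^σ M`: the group `M` with `a * m * b = σ(a) m b`. -/
def Twist (_σ : A ≃ₐ[k] A) (M : Type*) : Type _ := M

variable (σ : A ≃ₐ[k] A) (M : Type*) [AddCommGroup M] [Module k M] [Module A M] [Module Aᵐᵒᵖ M]

instance : AddCommGroup (Twist σ M) := inferInstanceAs (AddCommGroup M)

instance : Module k (Twist σ M) := inferInstanceAs (Module k M)

instance : Module Aᵐᵒᵖ (Twist σ M) := inferInstanceAs (Module Aᵐᵒᵖ M)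

instance : Module A (Twist σ M) := Module.compHom M (σ : A →+* A)

/-- The identity map `M → ^σ M`, which does not respect the left actions. -/
def Twist.of : M ≃ₗ[k] Twist σ M := LinearEquiv.refl k M

theorem Twist.smul_of (a : A) (m : M) : a • Twist.of σ M m = Twist.of σ M (σ a • m) := rfl

theorem Twist.op_smul_of (b : Aᵐᵒᵖ) (m : M) : b • Twist.of σ M m = Twist.of σ M (b • m) := rfl

instance [SMulCommClass A Aᵐᵒᵖ M] : SMulCommClass A Aᵐᵒᵖ (Twist σ M) where
  smul_comm a b m := smul_comm (σ a) b ((Twist.of σ M).symm m)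

instance [IsScalarTower k A M] : IsScalarTower k A (Twist σ M) where
  smul_assoc c a m := by
    obtain ⟨m, rfl⟩ := (Twist.of σ M).surjective m
    rw [Twist.smul_of, Twist.smul_of, map_smul σ, smul_assoc, map_smul (Twist.of σ M)]

instance [IsScalarTower k Aᵐᵒᵖ M] : IsScalarTower k Aᵐᵒᵖ (Twist σ M) :=
  inferInstanceAs (IsScalarTower k Aᵐᵒᵖ M)

end Twist

/-! ### Artin-Schelter regular Hopf algebras and the left homological integral -/

section ASRegular

/-- The (left) global dimension of a ring. -/
def globalDimension (A : Type u) [Ring A] : WithBot ℕ∞ :=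
  ⨆ M : ModuleCat.{u} A, projectiveDimension M

variable (k A : Type u) [Field k] [Ring A] [HopfAlgebra k A]

/-- The trivial left module `k = A / ker ε`. -/
def trivialLeft : ModuleCat.{u} A :=
  (ModuleCat.restrictScalars (Bialgebra.counitAlgHom k A : A →+* k)).obj (ModuleCat.of k k)

/-- The trivial right module `k = A / ker ε`. -/
def trivialRight : ModuleCat.{u} Aᵐᵒᵖ :=
  (ModuleCat.restrictScalars ((Bialgebra.counitAlgHom k A : A →+* k).fromOpposite
    fun _ _ => Commute.all _ _)).obj (ModuleCat.of k k)

/-- A Hopf algebra is Artin-Schelter regular of dimension `d` if `A` has injective dimension `d`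
as a left and as a right module over itself, `Ext^i(k, A)` is one-dimensional for `i = d` and zero
for `i ≠ d`, for left modules and for right modules, and `A` has global dimension `d`. -/
structure IsASRegular (d : ℕ) : Prop where
  injectiveDimension_left : injectiveDimension (ModuleCat.of A A) = (d : WithBot ℕ∞)
  finrank_ext_left : Module.finrank k (Ext (trivialLeft k A) (ModuleCat.of A A) d) = 1
  subsingleton_ext_left : ∀ i : ℕ, i ≠ d →
    Subsingleton (Ext (trivialLeft k A) (ModuleCat.of A A) i)
  injectiveDimension_right : injectiveDimension (ModuleCat.of Aᵐᵒᵖ A) = (d : WithBot ℕ∞)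
  finrank_ext_right : Module.finrank k (Ext (trivialRight k A) (ModuleCat.of Aᵐᵒᵖ A) d) = 1
  subsingleton_ext_right : ∀ i : ℕ, i ≠ d →
    Subsingleton (Ext (trivialRight k A) (ModuleCat.of Aᵐᵒᵖ A) i)
  globalDimension_eq : globalDimension A = (d : WithBot ℕ∞)

/-- The left homological integral `Ext^d_A(k, A)` (left modules). -/
abbrev LeftIntegral (d : ℕ) : Type u := Ext (trivialLeft k A) (ModuleCat.of A A) d

variable {A} in
/-- Right multiplication by `a`, an endomorphism of the left module `A`. -/
def rightMulHom (a : A) : ModuleCat.of A A ⟶ ModuleCat.of A A :=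
  ModuleCat.ofHom (LinearMap.toSpanSingleton A A a)

variable {A} in
/-- The right `A`-action on `Ext^d_A(k, A)`, induced by right multiplication on `A`. -/
def integralRightAct (d : ℕ) (a : A) : LeftIntegral k A d →ₗ[k] LeftIntegral k A d :=
  (Ext.mk₀ (rightMulHom a)).postcompOfLinear k (trivialLeft k A) (add_zero d)

theorem integralRightAct_apply (d : ℕ) (a : A) (x : LeftIntegral k A d) :
    integralRightAct k d a x = x.comp (Ext.mk₀ (rightMulHom a)) (add_zero d) := rfl

theorem integralRightAct_one (d : ℕ) : integralRightAct k d (1 : A) = LinearMap.id := by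
  have h : rightMulHom (1 : A) = 𝟙 _ := by ext; simp [rightMulHom]
  ext x
  simp [integralRightAct_apply, h]

theorem integralRightAct_mul (d : ℕ) (a b : A) :
    integralRightAct k d (a * b) = integralRightAct k d b ∘ₗ integralRightAct k d a := by
  have h : rightMulHom (a * b) = rightMulHom a ≫ rightMulHom b := by ext; simp [rightMulHom]
  ext x
  simp [integralRightAct_apply, h]

theorem integralRightAct_add (d : ℕ) (a b : A) :
    integralRightAct k d (a + b) = integralRightAct k d a + integralRightAct k d b := by
  have h : rightMulHom (a + b) = rightMulHom a + rightMulHom b := by ext; simp [rightMulHom]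
  ext x
  simp [integralRightAct_apply, h, Ext.mk₀_add]

theorem integralRightAct_smul (d : ℕ) (c : k) (a : A) :
    integralRightAct k d (c • a) = c • integralRightAct k d a := by
  let m : Module k (ModuleCat.of A A ⟶ ModuleCat.of A A) := Linear.homModule _ _
  have h : rightMulHom (c • a) = m.toSMul.smul c (rightMulHom a) := by
    ext
    change (1 : A) * (c • a) = algebraMap k A c * (1 * a)
    rw [one_mul, one_mul, Algebra.smul_def]
  ext x
  have h₁ : Ext.mk₀ (rightMulHom (c • a)) = c • Ext.mk₀ (rightMulHom a) := by
    rw [h]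
    exact Ext.mk₀_smul c (rightMulHom a)
  rw [integralRightAct_apply, h₁, Ext.comp_smul]
  rfl

variable {k A}

/-- The character `π₀ : A → A / r.ann(∫) ≅ k` by which `A` acts from the right on the
one-dimensional left integral: `x * a = π₀(a) x`. -/
def integralCharacter {d : ℕ} (h : Module.finrank k (LeftIntegral k A d) = 1) : A →ₐ[k] k :=
  let e := LinearEquiv.smul_id_of_finrank_eq_one (R := k) h
  AlgHom.ofLinearMap
    { toFun a := e.symm (integralRightAct k d a)
      map_add' a b := by rw [integralRightAct_add, map_add]
      map_smul' c a := by rw [integralRightAct_smul, map_smul]; rfl }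
    (by
      apply e.injective
      change e (e.symm _) = _
      rw [e.apply_symm_apply, integralRightAct_one]
      simp [e])
    (fun a b => by
      apply e.injective
      change e (e.symm _) = e (e.symm _ * e.symm _)
      rw [e.apply_symm_apply, integralRightAct_mul]
      obtain ⟨s, hs⟩ := e.surjective (integralRightAct k d a)
      obtain ⟨t, ht⟩ := e.surjective (integralRightAct k d b)
      rw [← hs, ← ht, e.symm_apply_apply, e.symm_apply_apply]
      ext x
      simp [e, smul_smul, mul_comm])

theorem integralRightAct_eq_smul {d : ℕ} (h : Module.finrank k (LeftIntegral k A d) = 1)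
    (a : A) (x : LeftIntegral k A d) :
    x.comp (Ext.mk₀ (rightMulHom a)) (add_zero d) = integralCharacter h a • x := by
  have := (LinearEquiv.smul_id_of_finrank_eq_one (R := k) h).apply_symm_apply
    (integralRightAct k d a)
  exact (congrArg (fun u => u x) this).symm

end ASRegular

/-! ### Winding automorphisms and the square of the antipode -/

section Winding

variable {k A : Type*} [Field k] [Ring A] [HopfAlgebra k A]

/-- The left winding endomorphism `a ↦ ∑ π(a₁) a₂`. -/
def leftWindingHom (π : A →ₐ[k] k) : A →ₐ[k] A :=
  (Algebra.TensorProduct.lid k A : k ⊗[k] A →ₐ[k] A).comp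
    ((Algebra.TensorProduct.map π (AlgHom.id k A)).comp (Bialgebra.comulAlgHom k A))

/-- The character `π ∘ S`. -/
def characterInv (π : A →ₐ[k] k) : A →ₐ[k] k :=
  AlgHom.ofLinearMap (π.toLinearMap ∘ₗ HopfAlgebra.antipode k)
    (by simp)
    (fun a b => by simp [HopfAlgebra.antipode_mul_antidistrib, mul_comm])

theorem leftWindingHom_repr (π : A →ₐ[k] k) {a : A} {ι : Type*} (r : Coalgebra.Repr k a ι) :
    leftWindingHom π a = ∑ i ∈ r.index, π (r.left i) • r.right i := by
  simp [leftWindingHom, ← r.eq]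

theorem leftWindingHom_comp (π φ : A →ₐ[k] k)
    (h : ∀ (a : A) (r : Coalgebra.Repr k a (A × A)),
      ∑ i ∈ r.index, φ (r.left i) * π (r.right i) = Coalgebra.counit (R := k) a) :
    (leftWindingHom π).comp (leftWindingHom φ) = AlgHom.id k A := by
  ext a
  let r := Coalgebra.Repr.arbitrary k a
  have key := congrArg (TensorProduct.lift (LinearMap.lsmul k A ∘ₗ φ.toLinearMap) ∘ₗ
      TensorProduct.map LinearMap.id (TensorProduct.lift (LinearMap.lsmul k A ∘ₗ π.toLinearMap)))
    (Coalgebra.sum_tmul_tmul_eq r (fun i => Coalgebra.Repr.arbitrary k (r.left i))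
      (fun i => Coalgebra.Repr.arbitrary k (r.right i)))
  simp only [map_sum, LinearMap.comp_apply, TensorProduct.map_tmul, TensorProduct.lift.tmul,
    LinearMap.id_apply, LinearMap.lsmul_apply, AlgHom.toLinearMap_apply, smul_smul,
    ← Finset.sum_smul, h, Coalgebra.sum_counit_smul] at key
  rw [AlgHom.comp_apply, leftWindingHom_repr φ r, map_sum, AlgHom.id_apply]
  simp only [map_smul, leftWindingHom_repr π (Coalgebra.Repr.arbitrary k (r.right _)),
    Finset.smul_sum, smul_smul]
  exact key.symm

theorem characterInv_apply (π : A →ₐ[k] k) (a : A) :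
    characterInv π a = π (HopfAlgebra.antipode k a) := rfl

theorem characterInv_left (π : A →ₐ[k] k) (a : A) (r : Coalgebra.Repr k a (A × A)) :
    ∑ i ∈ r.index, characterInv π (r.left i) * π (r.right i) = Coalgebra.counit (R := k) a := by
  have := congrArg π (HopfAlgebra.sum_antipode_mul_eq_algebraMap_counit r)
  simpa [characterInv_apply] using this

theorem characterInv_right (π : A →ₐ[k] k) (a : A) (r : Coalgebra.Repr k a (A × A)) :
    ∑ i ∈ r.index, π (r.left i) * characterInv π (r.right i) = Coalgebra.counit (R := k) a := by
  have := congrArg π (HopfAlgebra.sum_mul_antipode_eq_algebraMap_counit r)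
  simpa [characterInv_apply] using this

/-- The left winding automorphism `Ξ[π] : a ↦ ∑ π(a₁) a₂`, with inverse `Ξ[π ∘ S]`. -/
def leftWinding (π : A →ₐ[k] k) : A ≃ₐ[k] A :=
  AlgEquiv.ofAlgHom (leftWindingHom π) (leftWindingHom (characterInv π))
    (leftWindingHom_comp _ _ (characterInv_left π))
    (leftWindingHom_comp _ _ (characterInv_right π))

/-- The square `S²` of a bijective antipode, as an algebra automorphism. -/
def antipodeSq (hS : Function.Bijective (HopfAlgebra.antipode k : A →ₗ[k] A)) : A ≃ₐ[k] A :=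
  AlgEquiv.ofBijective
    (AlgHom.ofLinearMap (HopfAlgebra.antipode k ∘ₗ HopfAlgebra.antipode k) (by simp)
      (fun a b => by simp [HopfAlgebra.antipode_mul_antidistrib]))
    (hS.comp hS)

end Winding

end

end HopfDuality

/-! Both sides are identified with `Ext^i_A(k, ad M)`, where `ad M` is `M` with the left action `a ·
m = ∑ a₁ m S(a₂)`.

Cohomology: the invariants of `ad M` are the central elements of `M`
(`adAction_eq_counit_smul_iff`), so `H^0(A, M) = Hom_A(k, ad M)`. The bimodule `M` embeds into the
coinduced bimodule `Hom_k(A, M)`, whose Hochschild cohomology vanishes in positive degrees and whose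
adjoint module is again coinduced, hence injective (`adCoindEquiv`, `injective_coind`). Dimension
shifting on both sides gives `hochschildCohomology_equiv_ext`.

Homology: dually, `M` is a quotient of the induced bimodule `A ⊗ M`. Its twisted Hochschild homology
vanishes in positive degrees, and its adjoint module is free (`adIndEquiv`). Since `A` is noetherian
and `k` is finitely generated, the vanishing of `Ext^l(k, A)` for `l ≠ d` passes to all free modules
(`subsingleton_ext_of_free`). Each shift lowers the homological degree by one and raises the degree
of `Ext` by one, so everything is reduced to comparing `H_0` with `Ext^d`.

In that top degree, `Ext^d(k, -)` is right exact because the global dimension is `d`. Pushing a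
generator of the left integral along the maps `a ↦ a n` therefore gives `Ext^d(k, N) ≅ N / ⟨a n -
π₀(a) n⟩` (`topExtMap_surjective`, `ker_topExtMap`). For `N = ad M`, Sweedler calculus shows that
these relations span the same subspace as the elements `m a - σ(a) m` with `σ = ξ⁻¹ S⁻²`
(`map_commutatorRelations`). The quotient is `H_0(A, ^σ M)`; this is where the twist originates. -/

namespace HopfDuality

noncomputable section

/-! ### Isomorphisms of quotients from linear relations -/

section QuotientRelation

/-- Two quotients are isomorphic if they are related by a linear correspondence. -/
theorem nonempty_quotient_equiv_of_relation {k V W : Type*} [Ring k] [AddCommGroup V] [Module k V]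
    [AddCommGroup W] [Module k W] (V₀ : Submodule k V) (W₀ : Submodule k W)
    (R : Submodule k (V × W)) (hV : ∀ v, ∃ w, (v, w) ∈ R) (hW : ∀ w, ∃ v, (v, w) ∈ R)
    (h : ∀ v w, (v, w) ∈ R → (v ∈ V₀ ↔ w ∈ W₀)) : Nonempty ((V ⧸ V₀) ≃ₗ[k] (W ⧸ W₀)) := by
  let f : R →ₗ[k] V ⧸ V₀ := V₀.mkQ ∘ₗ LinearMap.fst k V W ∘ₗ R.subtype
  let g : R →ₗ[k] W ⧸ W₀ := W₀.mkQ ∘ₗ LinearMap.snd k V W ∘ₗ R.subtype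
  have hf : Function.Surjective f := fun x => by
    obtain ⟨v, rfl⟩ := V₀.mkQ_surjective x
    obtain ⟨w, hw⟩ := hV v
    exact ⟨⟨(v, w), hw⟩, rfl⟩
  have hg : Function.Surjective g := fun x => by
    obtain ⟨w, rfl⟩ := W₀.mkQ_surjective x
    obtain ⟨v, hv⟩ := hW w
    exact ⟨⟨(v, w), hv⟩, rfl⟩
  -- Both quotients are quotients of `R`, by the same kernel.
  have hfg : LinearMap.ker f = LinearMap.ker g := by
    ext ⟨⟨v, w⟩, hvw⟩
    simpa [f, g] using h v w hvw
  exact ⟨(f.quotKerEquivOfSurjective hf).symm ≪≫ₗ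
    Submodule.quotEquivOfEq _ _ hfg ≪≫ₗ g.quotKerEquivOfSurjective hg⟩

end QuotientRelation

/-! ### Hochschild cochains and coinduced bimodules -/

section Bimodule

variable {k A : Type u} [CommRing k] [Ring A] [Algebra k A]
variable {M N : Type u}
  [AddCommGroup M] [Module k M] [Module A M] [Module Aᵐᵒᵖ M]
  [SMulCommClass A Aᵐᵒᵖ M] [IsScalarTower k A M] [IsScalarTower k Aᵐᵒᵖ M]
  [AddCommGroup N] [Module k N] [Module A N] [Module Aᵐᵒᵖ N]
  [SMulCommClass A Aᵐᵒᵖ N] [IsScalarTower k A N] [IsScalarTower k Aᵐᵒᵖ N]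

variable (A) in
/-- A `k`-linear map which respects the actions of `A` on both sides. -/
structure IsBimoduleHom (f : M →ₗ[k] N) : Prop where
  map_smul : ∀ (a : A) (m : M), f (a • m) = a • f m
  map_op_smul : ∀ (b : Aᵐᵒᵖ) (m : M), f (b • m) = b • f m

theorem hochschildCoboundary_comp {f : M →ₗ[k] N} (hf : IsBimoduleHom A f) (n : ℕ)
    (c : HochschildCochain k A M n) :
    hochschildCoboundary k A N n (f.compMultilinearMap c) =
      f.compMultilinearMap (hochschildCoboundary k A M n c) := by
  ext a
  simp [hochschildCoboundary_apply, hf.map_smul, hf.map_op_smul]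

variable (k A M) in
/-- The coinduced bimodule `Hom_k(A, M)` with `(a f b)(x) = f(x a) b`. -/
def Coind : Type _ := A →ₗ[k] M

instance : AddCommGroup (Coind k A M) := inferInstanceAs (AddCommGroup (A →ₗ[k] M))
instance : Module k (Coind k A M) := inferInstanceAs (Module k (A →ₗ[k] M))
instance : FunLike (Coind k A M) A M := inferInstanceAs (FunLike (A →ₗ[k] M) A M)
instance : LinearMapClass (Coind k A M) k A M :=
  inferInstanceAs (LinearMapClass (A →ₗ[k] M) k A M)

namespace Coind

@[ext] theorem ext {f g : Coind k A M} (h : ∀ x, f x = g x) : f = g := LinearMap.ext h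

@[simp] theorem add_apply (f g : Coind k A M) (x : A) : (f + g) x = f x + g x := rfl
@[simp] theorem sub_apply (f g : Coind k A M) (x : A) : (f - g) x = f x - g x := rfl
@[simp] theorem zero_apply (x : A) : (0 : Coind k A M) x = 0 := rfl
@[simp] theorem smul_apply (c : k) (f : Coind k A M) (x : A) : (c • f) x = c • f x := rfl

instance : Module A (Coind k A M) where
  smul a f := LinearMap.comp (σ₁₂ := RingHom.id k) (f : A →ₗ[k] M) (LinearMap.mulRight k a)
  one_smul f := ext fun x => congrArg f (mul_one x)
  mul_smul a b f := ext fun x => congrArg f (mul_assoc x a b).symm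
  smul_zero _ := rfl
  smul_add _ _ _ := rfl
  add_smul a b f := ext fun x => (congrArg f (mul_add x a b)).trans (map_add f _ _)
  zero_smul f := ext fun x => (congrArg f (mul_zero x)).trans (map_zero f)

instance : Module Aᵐᵒᵖ (Coind k A M) := inferInstanceAs (Module Aᵐᵒᵖ (A →ₗ[k] M))

@[simp] theorem left_smul_apply (a : A) (f : Coind k A M) (x : A) : (a • f) x = f (x * a) := rfl
@[simp] theorem op_smul_apply (b : Aᵐᵒᵖ) (f : Coind k A M) (x : A) : (b • f) x = b • f x := rfl

instance : SMulCommClass A Aᵐᵒᵖ (Coind k A M) := ⟨fun _ _ _ => rfl⟩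
instance : IsScalarTower k A (Coind k A M) := ⟨fun c a f => ext fun x => by simp⟩
instance : IsScalarTower k Aᵐᵒᵖ (Coind k A M) := ⟨fun c a f => ext fun x => by simp⟩

variable (k A M) in
/-- The evaluation at `x`. -/
def eval (x : A) : Coind k A M →ₗ[k] M := LinearMap.applyₗ (R := k) (M₂ := M) x

@[simp] theorem eval_apply (x : A) (f : Coind k A M) : eval k A M x f = f x := rfl

variable (k A M) in
/-- The embedding `m ↦ (x ↦ x m)`. -/
def unit : M →ₗ[k] Coind k A M := (leftMul k A M).flip

@[simp] theorem unit_apply (m : M) (x : A) : unit k A M m x = x • m := rfl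

theorem isBimoduleHom_unit : IsBimoduleHom A (unit k A M) :=
  ⟨fun a m => ext fun x => by simp [mul_smul], fun b m => ext fun x => by simp [smul_comm x b]⟩

theorem unit_injective : Function.Injective (unit k A M) := fun m m' h => by
  simpa using congrArg (fun f => f 1) h

variable (k A M) in
/-- The retraction `G ↦ (y ↦ G(y)(1))` of `Coind (Coind M)` onto `Coind M`. -/
def counit : Coind k A (Coind k A M) →ₗ[k] Coind k A M :=
  LinearMap.llcomp k A (Coind k A M) M (eval k A M 1)

@[simp] theorem counit_apply (G : Coind k A (Coind k A M)) (x : A) :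
    counit k A M G x = G x 1 := rfl

theorem isBimoduleHom_counit : IsBimoduleHom A (counit k A M) :=
  ⟨fun _ _ => rfl, fun _ _ => rfl⟩

theorem counit_unit (f : Coind k A M) : counit k A M (unit k A (Coind k A M) f) = f :=
  ext fun x => by simp

end Coind

variable (k A M) in
/-- A cochain curried in its first variable, as a cochain with values in the coinduced bimodule. -/
def curryCochain (n : ℕ) :
    HochschildCochain k A M (n + 1) →ₗ[k] HochschildCochain k A (Coind k A M) n where
  toFun f :=
    { toFun v :=
        ({ toFun x := f (Fin.cons x v)
           map_add' x y := by simpa using f.map_update_add (Fin.cons 0 v) 0 x y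
           map_smul' c x := by simpa using f.map_update_smul (Fin.cons 0 v) 0 c x } : A →ₗ[k] M)
      map_update_add' {inst} v i y z := by
        obtain rfl : inst = instDecidableEqFin _ := Subsingleton.elim _ _
        exact Coind.ext fun x => by
          change f (Fin.cons x _) = f (Fin.cons x _) + f (Fin.cons x _)
          simp only [Fin.cons_update, f.map_update_add]
      map_update_smul' {inst} v i c y := by
        obtain rfl : inst = instDecidableEqFin _ := Subsingleton.elim _ _
        exact Coind.ext fun x => by
          change f (Fin.cons x _) = c • f (Fin.cons x _)
          simp only [Fin.cons_update, f.map_update_smul] }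
  map_add' _ _ := rfl
  map_smul' _ _ := rfl

@[simp] theorem curryCochain_apply (n : ℕ) (f : HochschildCochain k A M (n + 1)) (v : Fin n → A)
    (x : A) : curryCochain k A M n f v x = f (Fin.cons x v) := rfl

theorem curryCochain_injective (n : ℕ) : Function.Injective (curryCochain k A M n) := by
  intro f g h
  ext v
  have := congrArg (fun F => F (Fin.tail v) (v 0)) h
  simpa using this

theorem contractNth_zero_cons {n : ℕ} (x : A) (v : Fin (n + 1) → A) :
    (0 : Fin (n + 1)).castSucc.contractNth (· * ·) (Fin.cons x v : Fin (n + 2) → A) =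
      Fin.cons (x * v 0) (Fin.tail v) := by
  ext q
  refine Fin.cases ?_ (fun q => ?_) q
  · simp [Fin.contractNth]
  · simp [Fin.contractNth, Fin.tail]

theorem contractNth_succ_cons {n : ℕ} (j : Fin n) (x : A) (v : Fin (n + 1) → A) :
    j.succ.castSucc.contractNth (· * ·) (Fin.cons x v : Fin (n + 2) → A) =
      Fin.cons x (j.castSucc.contractNth (· * ·) v) := by
  ext q
  refine Fin.cases ?_ (fun q => ?_) q
  · simp [Fin.contractNth]
  · simp [Fin.contractNth, Fin.castSucc_succ]

theorem init_cons {n : ℕ} (x : A) (v : Fin (n + 1) → A) :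
    Fin.init (Fin.cons x v : Fin (n + 2) → A) = Fin.cons x (Fin.init v) := by
  ext q
  refine Fin.cases ?_ (fun q => ?_) q
  · simp [Fin.init]
  · simp [Fin.init, Fin.castSucc_succ]

theorem coind_sum_apply {ι : Type*} (s : Finset ι) (F : ι → Coind k A M) (x : A) :
    (∑ i ∈ s, F i) x = ∑ i ∈ s, F i x :=
  map_sum (Coind.eval k A M x) F s

/-- Currying the first variable is a nullhomotopy of the embedding into the coinduced bimodule. -/
theorem curryCochain_hochschildCoboundary (n : ℕ) (f : HochschildCochain k A M (n + 1)) :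
    curryCochain k A M (n + 1) (hochschildCoboundary k A M (n + 1) f) =
      (Coind.unit k A M).compMultilinearMap f -
        hochschildCoboundary k A (Coind k A M) n (curryCochain k A M n f) := by
  ext v x
  simp only [curryCochain_apply, hochschildCoboundary_apply, Fin.sum_univ_succ,
    contractNth_zero_cons, contractNth_succ_cons, init_cons, sub_apply,
    Coind.sub_apply, Coind.add_apply, coind_sum_apply, Coind.smul_apply, Coind.left_smul_apply,
    Coind.op_smul_apply, LinearMap.compMultilinearMap_apply, Coind.unit_apply]
  simp [pow_succ, Fin.tail_cons]
  abel

theorem hochschildCoboundary_zero_apply (f : HochschildCochain k A M 0) (a : Fin 1 → A) :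
    hochschildCoboundary k A M 0 f a = a 0 • f ![] - MulOpposite.op (a 0) • f ![] := by
  rw [hochschildCoboundary_apply]
  simp [Subsingleton.elim _ (![] : Fin 0 → A), sub_eq_add_neg]

/-- Induction on the degree, over all bimodules at once: by the homotopy formula, currying turns
`δδf` into `unit ∘ δf - δ(unit ∘ f) + δδ(curry f)`. The first two terms cancel, and the last one has
lower degree with coinduced coefficients. -/
theorem hochschildCoboundary_hochschildCoboundary (n : ℕ) (f : HochschildCochain k A M n) :
    hochschildCoboundary k A M (n + 1) (hochschildCoboundary k A M n f) = 0 := by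
  induction n generalizing M with
  | zero =>
    apply curryCochain_injective
    ext v x
    rw [curryCochain_hochschildCoboundary]
    simp [hochschildCoboundary_zero_apply, smul_sub, mul_smul, smul_comm x]
  | succ n ih =>
    apply curryCochain_injective
    rw [curryCochain_hochschildCoboundary, curryCochain_hochschildCoboundary, map_sub, ih,
      hochschildCoboundary_comp Coind.isBimoduleHom_unit, sub_zero, sub_self, map_zero]

/-- The Hochschild cohomology of a coinduced bimodule vanishes in positive degrees. -/
theorem exists_hochschildCoboundary_eq_of_coind (n : ℕ)
    (f : HochschildCochain k A (Coind k A M) (n + 1))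
    (hf : hochschildCoboundary k A _ (n + 1) f = 0) :
    ∃ g, hochschildCoboundary k A (Coind k A M) n g = f := by
  have h := curryCochain_hochschildCoboundary n f
  rw [hf, map_zero, eq_comm, sub_eq_zero] at h
  -- For a cocycle the homotopy formula reads `unit ∘ f = δ(curry f)`; the bimodule retraction of
  -- `unit`, available for coinduced coefficients, removes `unit`.
  refine ⟨(Coind.counit k A M).compMultilinearMap (curryCochain k A _ n f), ?_⟩
  rw [hochschildCoboundary_comp Coind.isBimoduleHom_counit, ← h]
  ext v : 1
  exact Coind.counit_unit _

end Bimodule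

/-! ### Dimension shifting for Hochschild cohomology -/

section CohomologyShift

variable {k A : Type u} [Field k] [Ring A] [Algebra k A]
variable {M N P : Type u}
  [AddCommGroup M] [Module k M] [Module A M] [Module Aᵐᵒᵖ M]
  [SMulCommClass A Aᵐᵒᵖ M] [IsScalarTower k A M] [IsScalarTower k Aᵐᵒᵖ M]
  [AddCommGroup N] [Module k N] [Module A N] [Module Aᵐᵒᵖ N]
  [SMulCommClass A Aᵐᵒᵖ N] [IsScalarTower k A N] [IsScalarTower k Aᵐᵒᵖ N]
  [AddCommGroup P] [Module k P] [Module A P] [Module Aᵐᵒᵖ P]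
  [SMulCommClass A Aᵐᵒᵖ P] [IsScalarTower k A P] [IsScalarTower k Aᵐᵒᵖ P]

/-- Over a field `g` has a `k`-linear section, which need not respect the actions of `A`. Cochains
are only `k`-multilinear, so that suffices. -/
theorem exists_compMultilinearMap_eq_of_surjective {g : N →ₗ[k] P} (hg : Function.Surjective g)
    {n : ℕ} (c : HochschildCochain k A P n) :
    ∃ b : HochschildCochain k A N n, g.compMultilinearMap b = c := by
  obtain ⟨s, hs⟩ := g.exists_rightInverse_of_surjective (LinearMap.range_eq_top.2 hg)
  exact ⟨s.compMultilinearMap c, by ext v; exact LinearMap.congr_fun hs _⟩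

theorem exists_compMultilinearMap_eq_of_exact {f : M →ₗ[k] N} {g : N →ₗ[k] P}
    (hf : Function.Injective f) (hfg : Function.Exact f g) {n : ℕ}
    (b : HochschildCochain k A N n) (hb : g.compMultilinearMap b = 0) :
    ∃ a : HochschildCochain k A M n, f.compMultilinearMap a = b := by
  obtain ⟨s, hs⟩ := f.exists_leftInverse_of_injective (LinearMap.ker_eq_bot.2 hf)
  refine ⟨s.compMultilinearMap b, ?_⟩
  ext v
  obtain ⟨m, hm⟩ := (hfg _).1 (congrArg (fun c => c v) hb)
  have := LinearMap.congr_fun hs m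
  have h₂ : f (s (f m)) = f m := congrArg f this
  simpa [hm] using h₂

theorem compMultilinearMap_injective {f : M →ₗ[k] N} (hf : Function.Injective f) {n : ℕ} :
    Function.Injective fun a : HochschildCochain k A M n => f.compMultilinearMap a :=
  fun _ _ h => MultilinearMap.ext fun v => hf (congrArg (fun c => c v) h)

theorem hochschildCoboundary_of_mem_coboundaries {n : ℕ} {c : HochschildCochain k A M n}
    (hc : c ∈ hochschildCoboundaries k A M n) : hochschildCoboundary k A M n c = 0 := by
  cases n with
  | zero => rw [(Submodule.mem_bot k).1 hc, map_zero]
  | succ n =>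
    obtain ⟨b, rfl⟩ := hc
    exact hochschildCoboundary_hochschildCoboundary n b

theorem exists_mem_coboundaries_of_surjective {g : N →ₗ[k] P} (hg : IsBimoduleHom A g)
    (hg' : Function.Surjective g) {n : ℕ} {c : HochschildCochain k A P n}
    (hc : c ∈ hochschildCoboundaries k A P n) :
    ∃ b ∈ hochschildCoboundaries k A N n, g.compMultilinearMap b = c := by
  cases n with
  | zero => exact ⟨0, zero_mem _, by rw [(Submodule.mem_bot k).1 hc]; simp⟩
  | succ n =>
    obtain ⟨b, rfl⟩ := hc
    obtain ⟨b, rfl⟩ := exists_compMultilinearMap_eq_of_surjective hg' b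
    exact ⟨_, ⟨b, rfl⟩, (hochschildCoboundary_comp hg n b).symm⟩

/-- The relation between `X` and `Z` underlying a connecting homomorphism: `x ∼ z` if there is
a `b` with `g b = z` and `d b = f x`. -/
def connectingRelation {X Y Y' Z : Type*} [AddCommGroup X] [Module k X] [AddCommGroup Y]
    [Module k Y] [AddCommGroup Y'] [Module k Y'] [AddCommGroup Z] [Module k Z]
    (f : X →ₗ[k] Y') (d : Y →ₗ[k] Y') (g : Y →ₗ[k] Z) : Submodule k (X × Z) where
  carrier := {x | ∃ b, g b = x.2 ∧ d b = f x.1}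
  add_mem' := by
    rintro x y ⟨b, hb, hb'⟩ ⟨c, hc, hc'⟩
    exact ⟨b + c, by simp [hb, hc], by simp [hb', hc']⟩
  zero_mem' := ⟨0, by simp, by simp⟩
  smul_mem' := by
    rintro t x ⟨b, hb, hb'⟩
    exact ⟨t • b, by simp [hb], by simp [hb']⟩

/-- Dimension shifting: in a short exact sequence `0 → M → N → P → 0` of bimodules with
`H^{n+1}(A, N) = 0` there is an isomorphism of `H^{n+1}(A, M)` with the cokernel of
`H^n(A, N) → H^n(A, P)`. -/
theorem hochschildCohomology_succ_equiv {f : M →ₗ[k] N} {g : N →ₗ[k] P}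
    (hf : IsBimoduleHom A f) (hg : IsBimoduleHom A g) (hf' : Function.Injective f)
    (hg' : Function.Surjective g) (hfg : Function.Exact f g) (n : ℕ)
    (hN : ∀ c, hochschildCoboundary k A N (n + 1) c = 0 →
      ∃ b, hochschildCoboundary k A N n b = c) :
    Nonempty (HochschildCohomology k A M (n + 1) ≃ₗ[k]
      hochschildCocycles k A P n ⧸ (hochschildCoboundaries k A P n ⊔
        (hochschildCocycles k A N n).map
          (g.compMultilinearMapₗ k (M₁ := fun _ : Fin n => A))).submoduleOf
            (hochschildCocycles k A P n)) := by
  have hgf : g ∘ₗ f = 0 := hfg.linearMap_comp_eq_zero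
  have hgf' {n : ℕ} (a : HochschildCochain k A M n) :
      g.compMultilinearMap (f.compMultilinearMap a) = 0 := by
    ext v
    exact LinearMap.congr_fun hgf _
  -- The connecting map is kept as the relation "some `b` has `g b = c` and `δ b = f a`", so no
  -- choice of `b` has to be made linearly.
  refine nonempty_quotient_equiv_of_relation _ _
    ((connectingRelation (f.compMultilinearMapₗ k (M₁ := fun _ : Fin (n + 1) => A))
      (hochschildCoboundary k A N n) (g.compMultilinearMapₗ k (M₁ := fun _ : Fin n => A))).comap
        ((hochschildCocycles k A M (n + 1)).subtype.prodMap
          (hochschildCocycles k A P n).subtype)) ?_ ?_ ?_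
  · rintro ⟨c, hc⟩
    replace hc : hochschildCoboundary k A M (n + 1) c = 0 := hc
    obtain ⟨b, hb⟩ := hN (f.compMultilinearMap c) (by
      rw [hochschildCoboundary_comp hf, hc]; simp)
    exact ⟨⟨g.compMultilinearMap b, by
      change hochschildCoboundary k A P n _ = 0
      rw [hochschildCoboundary_comp hg, hb, hgf']⟩, b, rfl, hb⟩
  · rintro ⟨c, hc⟩
    replace hc : hochschildCoboundary k A P n c = 0 := hc
    obtain ⟨b, rfl⟩ := exists_compMultilinearMap_eq_of_surjective hg' c
    rw [hochschildCoboundary_comp hg] at hc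
    obtain ⟨a, ha⟩ := exists_compMultilinearMap_eq_of_exact hf' hfg _ hc
    refine ⟨⟨a, ?_⟩, b, rfl, ha.symm⟩
    change hochschildCoboundary k A M (n + 1) a = 0
    apply compMultilinearMap_injective hf'
    dsimp only
    rw [← hochschildCoboundary_comp hf, ha, hochschildCoboundary_hochschildCoboundary]
    simp
  · rintro ⟨a, ha⟩ ⟨c, hc⟩ ⟨b, hb, hb'⟩
    replace hb : g.compMultilinearMap b = c := hb
    replace hb' : hochschildCoboundary k A N n b = f.compMultilinearMap a := hb'
    change a ∈ hochschildCoboundaries k A M (n + 1) ↔ c ∈ (_ ⊔ _ : Submodule k _)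
    constructor
    · rintro ⟨u, hu⟩
      replace hu : hochschildCoboundary k A M n u = a := hu
      refine Submodule.mem_sup_right ⟨b - f.compMultilinearMap u, ?_, ?_⟩
      · change hochschildCoboundary k A N n _ = 0
        rw [map_sub, hb', hochschildCoboundary_comp hf, hu, sub_self]
      · change g.compMultilinearMapₗ k (M₁ := fun _ : Fin n => A) _ = c
        rw [map_sub]
        change g.compMultilinearMap b - g.compMultilinearMap (f.compMultilinearMap u) = c
        rw [hgf', hb, sub_zero]
    · intro h
      obtain ⟨p, hp, q, ⟨z, hz, rfl⟩, hpq⟩ := Submodule.mem_sup.1 h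
      replace hz : hochschildCoboundary k A N n z = 0 := hz
      obtain ⟨w, hw, rfl⟩ := exists_mem_coboundaries_of_surjective hg hg' hp
      -- Here `w` is a coboundary lifting `p` and `z` is a cocycle, so correcting `b` by both puts
      -- it in the image of `f` without changing `δ b`.
      obtain ⟨u, hu⟩ := exists_compMultilinearMap_eq_of_exact hf' hfg (b - w - z) (by
        change g.compMultilinearMapₗ k (M₁ := fun _ : Fin n => A) _ = 0
        rw [map_sub, map_sub]
        change g.compMultilinearMap b - g.compMultilinearMap w - g.compMultilinearMap z = 0
        rw [hb, sub_sub, sub_eq_zero]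
        exact hpq.symm)
      refine ⟨u, ?_⟩
      apply compMultilinearMap_injective hf'
      dsimp only
      rw [← hochschildCoboundary_comp hf, hu, map_sub, map_sub, hz,
        hochschildCoboundary_of_mem_coboundaries hw, hb', sub_zero, sub_zero]

variable (k A M) in
/-- The quotient of the coinduced bimodule by `M`, realised as the maps `f : A → M` with
`f 1 = 0`. -/
def CoindQuotient : Type _ := LinearMap.ker (Coind.eval k A M 1)

namespace CoindQuotient

instance : AddCommGroup (CoindQuotient k A M) :=
  inferInstanceAs (AddCommGroup (LinearMap.ker (Coind.eval k A M 1)))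
instance : Module k (CoindQuotient k A M) :=
  inferInstanceAs (Module k (LinearMap.ker (Coind.eval k A M 1)))

variable (k A M) in
/-- The inclusion of the maps `f` with `f 1 = 0`, which only respects the right actions. -/
def incl : CoindQuotient k A M →ₗ[k] Coind k A M := (LinearMap.ker (Coind.eval k A M 1)).subtype

variable (k A M) in
/-- The projection `f ↦ (x ↦ f x - x f 1)`. -/
def proj : Coind k A M →ₗ[k] CoindQuotient k A M :=
  LinearMap.codRestrict _ (LinearMap.id - Coind.unit k A M ∘ₗ Coind.eval k A M 1)
    (fun f => by simp)

theorem incl_injective : Function.Injective (incl k A M) := Subtype.val_injective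

theorem incl_proj (f : Coind k A M) :
    incl k A M (proj k A M f) = f - Coind.unit k A M (f 1) := rfl

theorem proj_incl (q : CoindQuotient k A M) : proj k A M (incl k A M q) = q := by
  apply incl_injective
  have h : incl k A M q 1 = 0 := q.2
  rw [incl_proj, h, map_zero, sub_zero]

theorem proj_surjective : Function.Surjective (proj k A M) := fun q => ⟨_, proj_incl q⟩

theorem exact_unit_proj : Function.Exact (Coind.unit k A M) (proj k A M) := fun f => by
  rw [← incl_injective.eq_iff, incl_proj, map_zero, sub_eq_zero]
  refine ⟨fun h => ⟨_, h.symm⟩, ?_⟩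
  rintro ⟨m, rfl⟩
  simp

instance : SMul A (CoindQuotient k A M) := ⟨fun a q => proj k A M (a • incl k A M q)⟩
instance : SMul Aᵐᵒᵖ (CoindQuotient k A M) := ⟨fun b q => proj k A M (b • incl k A M q)⟩

/-- The kernel of `proj` is the image of `unit`, which is stable under the action. The action
defined through the section `incl` is therefore the quotient action, and the module axioms descend
along `proj`. -/
theorem proj_smul (a : A) (f : Coind k A M) : proj k A M (a • f) = a • proj k A M f := by
  apply incl_injective
  change _ = incl k A M (proj k A M (a • incl k A M (proj k A M f)))
  ext x
  simp [incl_proj, smul_sub, mul_smul]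

theorem proj_op_smul (b : Aᵐᵒᵖ) (f : Coind k A M) : proj k A M (b • f) = b • proj k A M f := by
  apply incl_injective
  change _ = incl k A M (proj k A M (b • incl k A M (proj k A M f)))
  ext x
  simp [incl_proj, smul_sub, smul_comm x]

instance : Module A (CoindQuotient k A M) :=
  Function.Surjective.module A (proj k A M).toAddMonoidHom proj_surjective proj_smul
instance : Module Aᵐᵒᵖ (CoindQuotient k A M) :=
  Function.Surjective.module Aᵐᵒᵖ (proj k A M).toAddMonoidHom proj_surjective proj_op_smul

theorem isBimoduleHom_proj : IsBimoduleHom A (proj k A M) := ⟨proj_smul, proj_op_smul⟩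

instance : SMulCommClass A Aᵐᵒᵖ (CoindQuotient k A M) := ⟨fun a b q => by
  obtain ⟨f, rfl⟩ := proj_surjective q
  simp only [← proj_smul, ← proj_op_smul, smul_comm]⟩
instance : IsScalarTower k A (CoindQuotient k A M) := ⟨fun c a q => by
  obtain ⟨f, rfl⟩ := proj_surjective q
  simp only [← proj_smul, ← map_smul, smul_assoc]⟩
instance : IsScalarTower k Aᵐᵒᵖ (CoindQuotient k A M) := ⟨fun c a q => by
  obtain ⟨f, rfl⟩ := proj_surjective q
  simp only [← proj_op_smul, ← map_smul, smul_assoc]⟩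

end CoindQuotient

/-- The zeroth Hochschild cohomology consists of the central elements of the bimodule. -/
theorem mem_hochschildCocycles_zero (c : HochschildCochain k A M 0) :
    c ∈ hochschildCocycles k A M 0 ↔ ∀ a : A, a • c ![] = MulOpposite.op a • c ![] := by
  change hochschildCoboundary k A M 0 c = 0 ↔ _
  refine ⟨fun h a => ?_, fun h => ?_⟩
  · have := congrArg (fun f => f ![a]) h
    simpa [hochschildCoboundary_zero_apply, sub_eq_zero] using this
  · ext v
    simpa [hochschildCoboundary_zero_apply, sub_eq_zero] using h (v 0)

end CohomologyShift

/-! ### Hochschild chains and induced bimodules -/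

section Homology

variable {k A : Type u} [CommRing k] [Ring A] [Algebra k A]
variable {M N P : Type u}
  [AddCommGroup M] [Module k M] [Module A M] [Module Aᵐᵒᵖ M]
  [SMulCommClass A Aᵐᵒᵖ M] [IsScalarTower k A M] [IsScalarTower k Aᵐᵒᵖ M]
  [AddCommGroup N] [Module k N] [Module A N] [Module Aᵐᵒᵖ N]
  [SMulCommClass A Aᵐᵒᵖ N] [IsScalarTower k A N] [IsScalarTower k Aᵐᵒᵖ N]

variable (A) in
/-- The map on Hochschild chains induced by a map of coefficients. -/
def chainMap (f : M →ₗ[k] N) (n : ℕ) : HochschildChain k A M n →ₗ[k] HochschildChain k A N n :=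
  f.rTensor _

@[simp] theorem chainMap_tmul (f : M →ₗ[k] N) (n : ℕ) (m : M) (t : ⨂[k] _ : Fin n, A) :
    chainMap A f n (m ⊗ₜ t) = f m ⊗ₜ t := rfl

theorem chain_hom_ext {X : Type*} [AddCommGroup X] [Module k X] {n : ℕ}
    {f g : HochschildChain k A M n →ₗ[k] X}
    (h : ∀ m v, f (m ⊗ₜ PiTensorProduct.tprod k v) = g (m ⊗ₜ PiTensorProduct.tprod k v)) :
    f = g :=
  TensorProduct.ext <| LinearMap.ext fun m => PiTensorProduct.ext <| MultilinearMap.ext fun v =>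
    h m v

theorem hochschildBoundary_chainMap {f : M →ₗ[k] N} (hf : IsBimoduleHom A f) (n : ℕ)
    (c : HochschildChain k A M (n + 1)) :
    hochschildBoundary k A N n (chainMap A f (n + 1) c) =
      chainMap A f n (hochschildBoundary k A M n c) := by
  refine LinearMap.congr_fun (f := hochschildBoundary k A N n ∘ₗ chainMap A f (n + 1))
    (g := chainMap A f n ∘ₗ hochschildBoundary k A M n) (chain_hom_ext fun m v => ?_) c
  simp [hochschildBoundary_tmul, hf.map_smul, hf.map_op_smul]

variable (k A M) in
/-- The induced bimodule `A ⊗ M` with `a (x ⊗ m) b = a x ⊗ m b`. -/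
def Ind : Type _ := A ⊗[k] M

namespace Ind

instance : AddCommGroup (Ind k A M) := inferInstanceAs (AddCommGroup (A ⊗[k] M))
instance : Module k (Ind k A M) := inferInstanceAs (Module k (A ⊗[k] M))
instance : Module A (Ind k A M) := inferInstanceAs (Module A (A ⊗[k] M))
instance : IsScalarTower k A (Ind k A M) := inferInstanceAs (IsScalarTower k A (A ⊗[k] M))
instance : Module Aᵐᵒᵖ (Ind k A M) :=
  Module.compHom (A ⊗[k] M) ((Module.End.lTensorAlgHom k M A).comp
    (Algebra.lsmul k k M : Aᵐᵒᵖ →ₐ[k] Module.End k M)).toRingHom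

variable (k A M) in
/-- The bilinear map `(x, m) ↦ x ⊗ m`. -/
def mk : A →ₗ[k] M →ₗ[k] Ind k A M := TensorProduct.mk k A M

@[elab_as_elim] theorem induction {motive : Ind k A M → Prop} (t : Ind k A M)
    (zero : motive 0) (mk : ∀ x m, motive (mk k A M x m))
    (add : ∀ s t, motive s → motive t → motive (s + t)) : motive t :=
  TensorProduct.induction_on t zero mk add

theorem smul_mk (a x : A) (m : M) : a • mk k A M x m = mk k A M (a * x) m := rfl

theorem op_smul_mk (b : Aᵐᵒᵖ) (x : A) (m : M) : b • mk k A M x m = mk k A M x (b • m) := rfl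

theorem hom_ext {X : Type*} [AddCommGroup X] [Module k X] {f g : Ind k A M →ₗ[k] X}
    (h : ∀ x m, f (mk k A M x m) = g (mk k A M x m)) : f = g :=
  TensorProduct.ext' (M := A) (N := M) h

variable (k) in
/-- The linear map out of the induced bimodule given by a bilinear map. -/
def lift {X : Type*} [AddCommGroup X] [Module k X] (f : A →ₗ[k] M →ₗ[k] X) : Ind k A M →ₗ[k] X :=
  TensorProduct.lift f

@[simp] theorem lift_mk {X : Type*} [AddCommGroup X] [Module k X] (f : A →ₗ[k] M →ₗ[k] X)
    (x : A) (m : M) : lift k f (mk k A M x m) = f x m := rfl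

instance : SMulCommClass A Aᵐᵒᵖ (Ind k A M) := ⟨fun a b t => by
  induction t using Ind.induction with
  | zero => simp
  | mk x m => simp only [smul_mk, op_smul_mk]
  | add s t hs ht => simp only [smul_add, hs, ht]⟩

instance : IsScalarTower k Aᵐᵒᵖ (Ind k A M) := ⟨fun c b t => by
  induction t using Ind.induction with
  | zero => simp
  | mk x m => rw [op_smul_mk, op_smul_mk, smul_assoc, map_smul]
  | add s t hs ht => simp only [smul_add, hs, ht]⟩

variable (k A M) in
/-- The action map `x ⊗ m ↦ x m`. -/
def counit : Ind k A M →ₗ[k] M := lift k (leftMul k A M)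

@[simp] theorem counit_mk (x : A) (m : M) : counit k A M (mk k A M x m) = x • m := rfl

theorem isBimoduleHom_counit : IsBimoduleHom A (counit k A M) := by
  constructor
  · intro a t
    induction t using Ind.induction with
    | zero => simp
    | mk x m => simp [smul_mk, mul_smul]
    | add s t hs ht => simp only [smul_add, map_add, hs, ht]
  · intro b t
    induction t using Ind.induction with
    | zero => simp
    | mk x m => simp [op_smul_mk, smul_comm x]
    | add s t hs ht => simp only [smul_add, map_add, hs, ht]

theorem counit_surjective : Function.Surjective (counit k A M) := fun m =>
  ⟨mk k A M 1 m, by simp⟩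

end Ind

variable (k A) in
/-- The map `x ⊗ (a_0 ⊗ ⋯ ⊗ a_{n-1}) ↦ a_0 ⊗ ⋯ ⊗ a_{n-1} ⊗ x`. -/
def snocTensor (n : ℕ) : A ⊗[k] (⨂[k] _ : Fin n, A) →ₗ[k] ⨂[k] _ : Fin (n + 1), A :=
  TensorProduct.lift (PiTensorProduct.lift
    (MultilinearMap.curryRight (PiTensorProduct.tprod k (s := fun _ : Fin (n + 1) => A)))).flip

@[simp] theorem snocTensor_tmul (n : ℕ) (x : A) (v : Fin n → A) :
    snocTensor k A n (x ⊗ₜ PiTensorProduct.tprod k v) =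
      PiTensorProduct.tprod k (Fin.snoc v x : Fin (n + 1) → A) := by
  simp [snocTensor]

variable (k A M) in
/-- The map `(x ⊗ m) ⊗ (a_0 ⊗ ⋯ ⊗ a_{n-1}) ↦ m ⊗ (a_0 ⊗ ⋯ ⊗ a_{n-1} ⊗ x)` from chains with values
in the induced bimodule. -/
def snocChain (n : ℕ) : HochschildChain k A (Ind k A M) n →ₗ[k] HochschildChain k A M (n + 1) :=
  (snocTensor k A n).lTensor M ∘ₗ
    (TensorProduct.assoc k M A (⨂[k] _ : Fin n, A)).toLinearMap ∘ₗ
      (Ind.lift k (TensorProduct.mk k M A).flip).rTensor (⨂[k] _ : Fin n, A)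

@[simp] theorem snocChain_tmul (n : ℕ) (x : A) (m : M) (v : Fin n → A) :
    snocChain k A M n (Ind.mk k A M x m ⊗ₜ PiTensorProduct.tprod k v) =
      m ⊗ₜ PiTensorProduct.tprod k (Fin.snoc v x : Fin (n + 1) → A) := by
  change m ⊗ₜ[k] snocTensor k A n (x ⊗ₜ PiTensorProduct.tprod k v) = _
  rw [snocTensor_tmul]

theorem indChain_hom_ext {X : Type*} [AddCommGroup X] [Module k X] {n : ℕ}
    {f g : HochschildChain k A (Ind k A M) n →ₗ[k] X}
    (h : ∀ x m v, f (Ind.mk k A M x m ⊗ₜ PiTensorProduct.tprod k v) =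
      g (Ind.mk k A M x m ⊗ₜ PiTensorProduct.tprod k v)) : f = g := by
  refine chain_hom_ext fun t v => ?_
  refine LinearMap.congr_fun (f := f ∘ₗ (TensorProduct.mk k _ _).flip (PiTensorProduct.tprod k v))
    (g := g ∘ₗ (TensorProduct.mk k _ _).flip (PiTensorProduct.tprod k v))
    (Ind.hom_ext fun x m => h x m v) t

/-- Every pure tensor is in the image of `snocChain`: its last entry can be split off into the
coefficients. -/
theorem snocChain_ext {X : Type*} [AddCommGroup X] [Module k X] {n : ℕ}
    {f g : HochschildChain k A M (n + 1) →ₗ[k] X}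
    (h : ∀ c, f (snocChain k A M n c) = g (snocChain k A M n c)) : f = g :=
  chain_hom_ext fun m v => by
    simpa using h (Ind.mk k A M (v (Fin.last n)) m ⊗ₜ PiTensorProduct.tprod k (Fin.init v))

theorem contractNth_castSucc_snoc {n : ℕ} (j : Fin n) (x : A) (v : Fin (n + 1) → A) :
    j.castSucc.castSucc.contractNth (· * ·) (Fin.snoc v x : Fin (n + 2) → A) =
      Fin.snoc (j.castSucc.contractNth (· * ·) v) x := by
  ext q
  refine Fin.lastCases ?_ (fun q => ?_) q
  · have h : ¬ (n < (j : ℕ)) := by omega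
    have h' : n ≠ (j : ℕ) := by omega
    simp [Fin.contractNth, h, h']
  · simp [Fin.contractNth, Fin.succ_castSucc, - Fin.castSucc_succ]

theorem contractNth_last_snoc {n : ℕ} (x : A) (v : Fin (n + 1) → A) :
    (Fin.last n).castSucc.contractNth (· * ·) (Fin.snoc v x : Fin (n + 2) → A) =
      Fin.snoc (Fin.init v) (v (Fin.last n) * x) := by
  ext q
  refine Fin.lastCases ?_ (fun q => ?_) q
  · simp [Fin.contractNth]
  · simp [Fin.contractNth, Fin.init]

theorem tail_snoc {n : ℕ} (x : A) (v : Fin (n + 1) → A) :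
    Fin.tail (Fin.snoc v x : Fin (n + 2) → A) = Fin.snoc (Fin.tail v) x := by
  ext q
  refine Fin.lastCases ?_ (fun q => ?_) q
  · simp [Fin.tail]
  · simp [Fin.tail, Fin.succ_castSucc, - Fin.castSucc_succ]

/-- Up to sign, `snocChain` is a nullhomotopy of the action map of the induced bimodule. -/
theorem hochschildBoundary_snocChain (n : ℕ) (c : HochschildChain k A (Ind k A M) (n + 1)) :
    hochschildBoundary k A M (n + 1) (snocChain k A M (n + 1) c) =
      snocChain k A M n (hochschildBoundary k A (Ind k A M) n c) +
        (-1 : k) ^ n • chainMap A (Ind.counit k A M) (n + 1) c := by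
  refine LinearMap.congr_fun (f := hochschildBoundary k A M (n + 1) ∘ₗ snocChain k A M (n + 1))
    (g := snocChain k A M n ∘ₗ hochschildBoundary k A (Ind k A M) n +
        (-1 : k) ^ n • chainMap A (Ind.counit k A M) (n + 1)) (indChain_hom_ext fun x m v => ?_) c
  have h0 : (Fin.snoc v x : Fin (n + 2) → A) 0 = v 0 := by
    rw [← Fin.castSucc_zero, Fin.snoc_castSucc]
  simp only [LinearMap.comp_apply, LinearMap.add_apply, LinearMap.smul_apply, snocChain_tmul,
    hochschildBoundary_tmul, Fin.sum_univ_castSucc, contractNth_castSucc_snoc,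
    contractNth_last_snoc, tail_snoc, h0, Fin.snoc_last, Fin.init_snoc, map_add, map_sum, map_smul,
    Ind.smul_mk, Ind.op_smul_mk, chainMap_tmul, Ind.counit_mk, Fin.val_last, Fin.val_castSucc]
  simp only [pow_succ]
  module

end Homology

/-! ### Acyclicity of retracts of induced bimodules -/

section HomologyVanishing

variable {k A : Type u} [CommRing k] [Ring A] [Algebra k A]
variable {M N : Type u}
  [AddCommGroup M] [Module k M] [Module A M] [Module Aᵐᵒᵖ M]
  [SMulCommClass A Aᵐᵒᵖ M] [IsScalarTower k A M] [IsScalarTower k Aᵐᵒᵖ M]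
  [AddCommGroup N] [Module k N] [Module A N] [Module Aᵐᵒᵖ N]
  [SMulCommClass A Aᵐᵒᵖ N] [IsScalarTower k A N] [IsScalarTower k Aᵐᵒᵖ N]

theorem chainMap_surjective {f : M →ₗ[k] N} (hf : Function.Surjective f) (n : ℕ) :
    Function.Surjective (chainMap A f n) := LinearMap.rTensor_surjective _ hf

theorem hochschildBoundary_zero_tmul (m : M) (a : Fin 1 → A) :
    hochschildBoundary k A M 0 (m ⊗ₜ PiTensorProduct.tprod k a) =
      (MulOpposite.op (a 0) • m - a 0 • m) ⊗ₜ PiTensorProduct.tprod k ![] := by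
  rw [hochschildBoundary_tmul]
  simp [Subsingleton.elim _ (![] : Fin 0 → A), sub_eq_add_neg, TensorProduct.add_tmul,
    TensorProduct.neg_tmul]

/-- Dual to the argument for cochains: chains in the image of `snocChain` suffice, and there the
homotopy formula leaves a double boundary of lower degree and two terms with opposite signs. -/
theorem hochschildBoundary_hochschildBoundary (n : ℕ) (c : HochschildChain k A M (n + 2)) :
    hochschildBoundary k A M n (hochschildBoundary k A M (n + 1) c) = 0 := by
  induction n generalizing M with
  | zero =>
    refine LinearMap.congr_fun (f := hochschildBoundary k A M 0 ∘ₗ hochschildBoundary k A M 1)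
      (g := 0) (chain_hom_ext fun m v => ?_) c
    have h1 : Fin.last 1 = 1 := rfl
    simp [hochschildBoundary_tmul k A M 1, hochschildBoundary_zero_tmul, Fin.tail, Fin.init,
      Fin.contractNth, h1, mul_smul, smul_comm (v 1) (MulOpposite.op (v 0))]
    simp [← TensorProduct.add_tmul, ← TensorProduct.neg_tmul]
  | succ n ih =>
    refine LinearMap.congr_fun
      (f := hochschildBoundary k A M (n + 1) ∘ₗ hochschildBoundary k A M (n + 2))
      (g := 0) (snocChain_ext fun b => ?_) c
    rw [LinearMap.comp_apply, hochschildBoundary_snocChain, map_add, map_smul,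
      hochschildBoundary_snocChain, ih, hochschildBoundary_chainMap Ind.isBimoduleHom_counit,
      map_zero, zero_add, LinearMap.zero_apply, pow_succ]
    module

/-- The Hochschild homology of a retract of an induced bimodule vanishes in positive degrees. -/
theorem exists_hochschildBoundary_eq_of_section {s : M →ₗ[k] Ind k A M} (hs : IsBimoduleHom A s)
    (hs' : Ind.counit k A M ∘ₗ s = LinearMap.id) (n : ℕ) (c : HochschildChain k A M (n + 1))
    (hc : hochschildBoundary k A M n c = 0) :
    ∃ b, hochschildBoundary k A M (n + 1) b = c := by
  have h := hochschildBoundary_snocChain n (chainMap A s (n + 1) c)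
  have h' : chainMap A (Ind.counit k A M) (n + 1) (chainMap A s (n + 1) c) = c := by
    change LinearMap.rTensor _ _ (LinearMap.rTensor _ _ c) = c
    rw [← LinearMap.rTensor_comp_apply, hs', LinearMap.rTensor_id_apply]
  rw [hochschildBoundary_chainMap hs, hc, map_zero, map_zero, zero_add, h'] at h
  -- As `c` is a cycle, the homotopy formula for `s c` has only the term `(-1)^n c` left; the sign
  -- is its own inverse.
  refine ⟨(-1 : k) ^ n • snocChain k A M (n + 1) (chainMap A s (n + 1) c), ?_⟩
  rw [map_smul, h, smul_smul, ← mul_pow]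
  simp

end HomologyVanishing

/-! ### Twisting induced bimodules -/

section Twist

variable {k A : Type u} [CommRing k] [Ring A] [Algebra k A] (σ : A ≃ₐ[k] A)
variable {M N : Type u}
  [AddCommGroup M] [Module k M] [Module A M] [Module Aᵐᵒᵖ M]
  [SMulCommClass A Aᵐᵒᵖ M] [IsScalarTower k A M] [IsScalarTower k Aᵐᵒᵖ M]
  [AddCommGroup N] [Module k N] [Module A N] [Module Aᵐᵒᵖ N]
  [SMulCommClass A Aᵐᵒᵖ N] [IsScalarTower k A N] [IsScalarTower k Aᵐᵒᵖ N]

/-- The map of twisted bimodules induced by a map of bimodules. -/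
def twistMap (f : M →ₗ[k] N) : Twist σ M →ₗ[k] Twist σ N :=
  (Twist.of σ N).toLinearMap ∘ₗ f ∘ₗ (Twist.of σ M).symm.toLinearMap

@[simp] theorem twistMap_of (f : M →ₗ[k] N) (m : M) :
    twistMap σ f (Twist.of (k := k) σ M m) = Twist.of (k := k) σ N (f m) := rfl

theorem isBimoduleHom_twistMap {f : M →ₗ[k] N} (hf : IsBimoduleHom A f) :
    IsBimoduleHom A (twistMap σ f) where
  map_smul a m := by
    obtain ⟨m, rfl⟩ := (Twist.of (k := k) σ M).surjective m
    rw [Twist.smul_of, twistMap_of, twistMap_of, Twist.smul_of, hf.map_smul]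
  map_op_smul b m := by
    obtain ⟨m, rfl⟩ := (Twist.of (k := k) σ M).surjective m
    rw [Twist.op_smul_of, twistMap_of, twistMap_of, Twist.op_smul_of, hf.map_op_smul]

variable (M) in
/-- A section of the action map of the twisted induced bimodule. -/
def twistIndSection : Twist σ (Ind k A M) →ₗ[k] Ind k A (Twist σ (Ind k A M)) :=
  Ind.lift k (((Ind.mk k A (Twist σ (Ind k A M))).compl₁₂ σ.symm.toLinearMap
    ((Twist.of σ (Ind k A M)).toLinearMap ∘ₗ Ind.mk k A M 1))) ∘ₗ
      (Twist.of σ (Ind k A M)).symm.toLinearMap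

theorem twistIndSection_mk (x : A) (m : M) :
    twistIndSection σ M (Twist.of (k := k) σ _ (Ind.mk k A M x m)) =
      Ind.mk k A _ (σ.symm x) (Twist.of (k := k) σ _ (Ind.mk k A M 1 m)) := rfl

/-- The left action on the source is `a · (x ⊗ m) = σ(a) x ⊗ m`, so applying `σ⁻¹` to the first
factor turns it into plain left multiplication. -/
theorem isBimoduleHom_twistIndSection : IsBimoduleHom A (twistIndSection σ M) where
  map_smul a t := by
    obtain ⟨t, rfl⟩ := (Twist.of (k := k) σ _).surjective t
    induction t using Ind.induction with
    | zero => simp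
    | mk x m => rw [Twist.smul_of, Ind.smul_mk, twistIndSection_mk, twistIndSection_mk,
        Ind.smul_mk, map_mul, σ.symm_apply_apply]
    | add s t hs ht => simp only [smul_add, map_add, hs, ht]
  map_op_smul b t := by
    obtain ⟨t, rfl⟩ := (Twist.of (k := k) σ _).surjective t
    induction t using Ind.induction with
    | zero => simp
    | mk x m => rw [Twist.op_smul_of, Ind.op_smul_mk, twistIndSection_mk, twistIndSection_mk,
        Ind.op_smul_mk, Twist.op_smul_of, Ind.op_smul_mk]
    | add s t hs ht => simp only [smul_add, map_add, hs, ht]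

theorem counit_twistIndSection :
    Ind.counit k A _ ∘ₗ twistIndSection σ M = LinearMap.id := by
  ext t
  obtain ⟨t, rfl⟩ := (Twist.of (k := k) σ _).surjective t
  induction t using Ind.induction with
  | zero => simp
  | mk x m =>
    rw [LinearMap.comp_apply, twistIndSection_mk, Ind.counit_mk, Twist.smul_of, Ind.smul_mk]
    simp
  | add s t hs ht => simp only [map_add, hs, ht]

/-- The Hochschild homology of a twisted induced bimodule vanishes in positive degrees. -/
theorem exists_hochschildBoundary_eq_of_twist_ind (n : ℕ)
    (c : HochschildChain k A (Twist σ (Ind k A M)) (n + 1))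
    (hc : hochschildBoundary k A _ n c = 0) : ∃ b, hochschildBoundary k A _ (n + 1) b = c :=
  exists_hochschildBoundary_eq_of_section (isBimoduleHom_twistIndSection σ)
    (counit_twistIndSection σ) n c hc

end Twist

/-! ### The kernel of the action map as a bimodule -/

section IndKernel

variable {k A : Type u} [CommRing k] [Ring A] [Algebra k A]
variable {M : Type u}
  [AddCommGroup M] [Module k M] [Module A M] [Module Aᵐᵒᵖ M]
  [SMulCommClass A Aᵐᵒᵖ M] [IsScalarTower k A M] [IsScalarTower k Aᵐᵒᵖ M]

variable (k A M) in
/-- The kernel of the action map `A ⊗ M → M`. -/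
def IndKernel : Type _ := LinearMap.ker (Ind.counit k A M)

namespace IndKernel

instance : AddCommGroup (IndKernel k A M) :=
  inferInstanceAs (AddCommGroup (LinearMap.ker (Ind.counit k A M)))
instance : Module k (IndKernel k A M) :=
  inferInstanceAs (Module k (LinearMap.ker (Ind.counit k A M)))

variable (k A M) in
/-- The inclusion of the kernel of the action map. -/
def incl : IndKernel k A M →ₗ[k] Ind k A M := (LinearMap.ker (Ind.counit k A M)).subtype

theorem incl_injective : Function.Injective (incl k A M) := Subtype.val_injective

theorem exact_incl_counit : Function.Exact (incl k A M) (Ind.counit k A M) :=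
  LinearMap.exact_subtype_ker_map _

theorem counit_incl (q : IndKernel k A M) : Ind.counit k A M (incl k A M q) = 0 := q.2

instance : SMul A (IndKernel k A M) := ⟨fun a q => ⟨a • incl k A M q, by
  rw [LinearMap.mem_ker, Ind.isBimoduleHom_counit.map_smul, counit_incl, smul_zero]⟩⟩
instance : SMul Aᵐᵒᵖ (IndKernel k A M) := ⟨fun b q => ⟨b • incl k A M q, by
  rw [LinearMap.mem_ker, Ind.isBimoduleHom_counit.map_op_smul, counit_incl, smul_zero]⟩⟩

theorem incl_smul (a : A) (q : IndKernel k A M) : incl k A M (a • q) = a • incl k A M q := rfl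
theorem incl_op_smul (b : Aᵐᵒᵖ) (q : IndKernel k A M) :
    incl k A M (b • q) = b • incl k A M q := rfl

instance : Module A (IndKernel k A M) :=
  Function.Injective.module A (incl k A M).toAddMonoidHom incl_injective incl_smul
instance : Module Aᵐᵒᵖ (IndKernel k A M) :=
  Function.Injective.module Aᵐᵒᵖ (incl k A M).toAddMonoidHom incl_injective incl_op_smul

theorem isBimoduleHom_incl : IsBimoduleHom A (incl k A M) := ⟨incl_smul, incl_op_smul⟩

instance : SMulCommClass A Aᵐᵒᵖ (IndKernel k A M) := ⟨fun a b q => incl_injective <| by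
  simp only [incl_smul, incl_op_smul, smul_comm]⟩
instance : IsScalarTower k A (IndKernel k A M) := ⟨fun c a q => incl_injective <| by
  simp only [incl_smul, map_smul, smul_assoc]⟩
instance : IsScalarTower k Aᵐᵒᵖ (IndKernel k A M) := ⟨fun c a q => incl_injective <| by
  simp only [incl_op_smul, map_smul, smul_assoc]⟩

end IndKernel

end IndKernel

/-! ### Dimension shifting for Hochschild homology -/

section HomologyShift

variable {k A : Type u} [Field k] [Ring A] [Algebra k A]
variable {M N P : Type u}
  [AddCommGroup M] [Module k M] [Module A M] [Module Aᵐᵒᵖ M]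
  [SMulCommClass A Aᵐᵒᵖ M] [IsScalarTower k A M] [IsScalarTower k Aᵐᵒᵖ M]
  [AddCommGroup N] [Module k N] [Module A N] [Module Aᵐᵒᵖ N]
  [SMulCommClass A Aᵐᵒᵖ N] [IsScalarTower k A N] [IsScalarTower k Aᵐᵒᵖ N]
  [AddCommGroup P] [Module k P] [Module A P] [Module Aᵐᵒᵖ P]
  [SMulCommClass A Aᵐᵒᵖ P] [IsScalarTower k A P] [IsScalarTower k Aᵐᵒᵖ P]

theorem chainMap_injective {f : M →ₗ[k] N} (hf : Function.Injective f) (n : ℕ) :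
    Function.Injective (chainMap A f n) := Module.Flat.rTensor_preserves_injective_linearMap f hf

theorem chainMap_exact {f : M →ₗ[k] N} {g : N →ₗ[k] P} (hfg : Function.Exact f g)
    (hg : Function.Surjective g) (n : ℕ) :
    Function.Exact (chainMap A f n) (chainMap A g n) := rTensor_exact _ hfg hg

theorem hochschildBoundary_mem_cycles (n : ℕ) (c : HochschildChain k A M (n + 1)) :
    hochschildBoundary k A M n c ∈ hochschildCycles k A M n := by
  cases n with
  | zero => trivial
  | succ n => exact hochschildBoundary_hochschildBoundary n c

theorem mem_hochschildCycles_of_chainMap {f : M →ₗ[k] N} (hf : IsBimoduleHom A f)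
    (hf' : Function.Injective f) {n : ℕ} {c : HochschildChain k A M n}
    (hc : chainMap A f n c ∈ hochschildCycles k A N n) : c ∈ hochschildCycles k A M n := by
  cases n with
  | zero => trivial
  | succ n =>
    apply chainMap_injective hf'
    rw [← hochschildBoundary_chainMap hf, map_zero]
    exact hc

theorem chainMap_mem_hochschildCycles {f : M →ₗ[k] N} (hf : IsBimoduleHom A f)
    {n : ℕ} {c : HochschildChain k A M n} (hc : c ∈ hochschildCycles k A M n) :
    chainMap A f n c ∈ hochschildCycles k A N n := by
  cases n with
  | zero => trivial
  | succ n =>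
    change hochschildBoundary k A N n _ = 0
    rw [hochschildBoundary_chainMap hf, LinearMap.mem_ker.1 hc, map_zero]

/-- Dimension shifting: in a short exact sequence `0 → M → N → P → 0` of bimodules with
`H_{n+1}(A, N) = 0` there is an isomorphism of `H_{n+1}(A, P)` with the kernel of
`H_n(A, M) → H_n(A, N)`. -/
theorem hochschildHomology_succ_equiv {f : M →ₗ[k] N} {g : N →ₗ[k] P}
    (hf : IsBimoduleHom A f) (hg : IsBimoduleHom A g) (hf' : Function.Injective f)
    (hg' : Function.Surjective g) (hfg : Function.Exact f g) (n : ℕ)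
    (hN : ∀ c, hochschildBoundary k A N n c = 0 → ∃ b, hochschildBoundary k A N (n + 1) b = c) :
    Nonempty (HochschildHomology k A P (n + 1) ≃ₗ[k]
      (hochschildBoundaries k A N n).comap (chainMap A f n) ⧸
        (hochschildBoundaries k A M n).submoduleOf
          ((hochschildBoundaries k A N n).comap (chainMap A f n))) := by
  have hgf {n : ℕ} (a : HochschildChain k A M n) : chainMap A g n (chainMap A f n a) = 0 :=
    (chainMap_exact hfg hg' n).apply_apply_eq_zero a
  -- The same connecting relation as for cohomology, with its components exchanged because the
  -- homological connecting map runs from `P` to `M`.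
  refine nonempty_quotient_equiv_of_relation _ _
    (((connectingRelation (chainMap A f n) (hochschildBoundary k A N n)
      (chainMap A g (n + 1))).map (LinearEquiv.prodComm k _ _).toLinearMap).comap
        ((hochschildCycles k A P (n + 1)).subtype.prodMap
          ((hochschildBoundaries k A N n).comap (chainMap A f n)).subtype)) ?_ ?_ ?_
  · rintro ⟨c, hc⟩
    replace hc : hochschildBoundary k A P n c = 0 := hc
    obtain ⟨b, rfl⟩ := chainMap_surjective hg' _ c
    rw [hochschildBoundary_chainMap hg] at hc
    obtain ⟨a, ha⟩ := (chainMap_exact hfg hg' n _).1 hc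
    exact ⟨⟨a, b, ha.symm⟩, (a, _), ⟨b, rfl, ha.symm⟩, rfl⟩
  · rintro ⟨a, b, hb⟩
    refine ⟨⟨chainMap A g (n + 1) b, ?_⟩, (a, _), ⟨b, rfl, hb⟩, rfl⟩
    change hochschildBoundary k A P n _ = 0
    rw [hochschildBoundary_chainMap hg, hb, hgf]
  · rintro ⟨c, hc⟩ ⟨a, ha⟩ ⟨⟨a', c'⟩, ⟨b, hb, hb'⟩, h⟩
    obtain ⟨rfl, rfl⟩ := Prod.mk.inj h
    replace hb : chainMap A g (n + 1) b = c' := hb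
    replace hb' : hochschildBoundary k A N n b = chainMap A f n a' := hb'
    change c' ∈ hochschildBoundaries k A P (n + 1) ↔ a' ∈ hochschildBoundaries k A M n
    constructor
    · rintro ⟨w, hw⟩
      obtain ⟨w, rfl⟩ := chainMap_surjective hg' _ w
      rw [hochschildBoundary_chainMap hg, ← hb, eq_comm, ← sub_eq_zero, ← map_sub] at hw
      obtain ⟨u, hu⟩ := (chainMap_exact hfg hg' _ _).1 hw
      refine ⟨u, chainMap_injective hf' n ?_⟩
      rw [← hochschildBoundary_chainMap hf, hu, map_sub, hochschildBoundary_hochschildBoundary,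
        sub_zero, hb']
    · rintro ⟨u, rfl⟩
      obtain ⟨w, hw⟩ := hN (b - chainMap A f (n + 1) u) (by
        rw [map_sub, hb', hochschildBoundary_chainMap hf, sub_self])
      refine ⟨chainMap A g (n + 2) w, ?_⟩
      rw [hochschildBoundary_chainMap hg, hw, map_sub, hgf, sub_zero, hb]

end HomologyShift

/-! ### Adjoint modules of bimodules over a Hopf algebra -/

/-- The left adjoint module of an `A`-bimodule `M`, with `a · m = ∑ a₁ m S(a₂)`. -/
def Ad (_k _A M : Type*) : Type _ := M

section Adjoint

open HopfAlgebra Coalgebra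

variable {k A : Type u} [Field k] [Ring A] [HopfAlgebra k A]
variable {M N P : Type u}
  [AddCommGroup M] [Module k M] [Module A M] [Module Aᵐᵒᵖ M]
  [SMulCommClass A Aᵐᵒᵖ M] [IsScalarTower k A M] [IsScalarTower k Aᵐᵒᵖ M]
  [AddCommGroup N] [Module k N] [Module A N] [Module Aᵐᵒᵖ N]
  [SMulCommClass A Aᵐᵒᵖ N] [IsScalarTower k A N] [IsScalarTower k Aᵐᵒᵖ N]
  [AddCommGroup P] [Module k P] [Module A P] [Module Aᵐᵒᵖ P]
  [SMulCommClass A Aᵐᵒᵖ P] [IsScalarTower k A P] [IsScalarTower k Aᵐᵒᵖ P]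

variable (k A) in
/-- The antipode as an algebra homomorphism to the opposite algebra. -/
def antipodeOp : A →ₐ[k] Aᵐᵒᵖ :=
  AlgHom.ofLinearMap ((MulOpposite.opLinearEquiv k).toLinearMap ∘ₗ antipode k)
    (by simp) (fun a b => by simp [antipode_mul_antidistrib])

variable (k A M) in
/-- The left adjoint action `a · m = ∑ a₁ m S(a₂)` on a bimodule. -/
def adAction : A →ₐ[k] Module.End k M :=
  (Algebra.TensorProduct.lift (Algebra.lsmul k k M : A →ₐ[k] Module.End k M)
    ((Algebra.lsmul k k M : Aᵐᵒᵖ →ₐ[k] Module.End k M).comp (antipodeOp k A))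
    (fun a _ => LinearMap.ext fun m => smul_comm a _ m)).comp (Bialgebra.comulAlgHom k A)

theorem adAction_apply (a : A) (m : M) {ι : Type*} (r : Repr k a ι) :
    adAction k A M a m =
      ∑ i ∈ r.index, r.left i • MulOpposite.op (antipode k (r.right i)) • m := by
  simp only [adAction, AlgHom.comp_apply, Bialgebra.comulAlgHom_apply, ← r.eq, map_sum,
    LinearMap.sum_apply]
  rfl

instance : AddCommGroup (Ad k A M) := inferInstanceAs (AddCommGroup M)
instance : Module k (Ad k A M) := inferInstanceAs (Module k M)
instance : Module A (Ad k A M) := Module.compHom M (adAction k A M).toRingHom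

variable (k A M) in
/-- The identity map from a bimodule to its adjoint module. -/
def Ad.of : M ≃ₗ[k] Ad k A M := LinearEquiv.refl k M

theorem Ad.smul_of (a : A) (m : M) :
    a • Ad.of k A M m = Ad.of k A M (adAction k A M a m) := rfl

instance : IsScalarTower k A (Ad k A M) := ⟨fun c a m => by
  obtain ⟨m, rfl⟩ := (Ad.of k A M).surjective m
  rw [Ad.smul_of, Ad.smul_of, map_smul, LinearMap.smul_apply, map_smul]⟩

/-- A linear map out of the adjoint module. -/
def Ad.desc {X : Type*} [AddCommGroup X] [Module k X] [Module A X] (f : M →ₗ[k] X)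
    (hf : ∀ (a : A) m, f (adAction k A M a m) = a • f m) : Ad k A M →ₗ[A] X where
  toFun := f
  map_add' := map_add f
  map_smul' := hf

/-- A linear map into the adjoint module. -/
def Ad.lift {X : Type*} [AddCommGroup X] [Module k X] [Module A X] (f : X →ₗ[k] M)
    (hf : ∀ (a : A) x, f (a • x) = adAction k A M a (f x)) : X →ₗ[A] Ad k A M where
  toFun := f
  map_add' := map_add f
  map_smul' := hf

theorem IsBimoduleHom.map_adAction {f : M →ₗ[k] N} (hf : IsBimoduleHom A f) (a : A) (m : M) :
    f (adAction k A M a m) = adAction k A N a (f m) := by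
  simp [adAction_apply _ _ (Repr.arbitrary k a), hf.map_smul, hf.map_op_smul]

/-- A map of bimodules as a map of adjoint modules. -/
def adLinearMap {f : M →ₗ[k] N} (hf : IsBimoduleHom A f) : Ad k A M →ₗ[A] Ad k A N where
  toFun := f
  map_add' := map_add f
  map_smul' := hf.map_adAction

variable (k A M) in
/-- The adjoint module as an object of the category of modules. -/
abbrev adModule : ModuleCat.{u} A := ModuleCat.of A (Ad k A M)

/-- A map of bimodules as a morphism of adjoint modules. -/
abbrev adMap {f : M →ₗ[k] N} (hf : IsBimoduleHom A f) : adModule k A M ⟶ adModule k A N :=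
  ModuleCat.ofHom (adLinearMap hf)

/-- The sequence of adjoint modules of an exact sequence of bimodules. -/
abbrev adShortComplex {f : M →ₗ[k] N} {g : N →ₗ[k] P} (hf : IsBimoduleHom A f)
    (hg : IsBimoduleHom A g) (hfg : Function.Exact f g) : ShortComplex (ModuleCat.{u} A) :=
  ShortComplex.mk (adMap hf) (adMap hg) (ModuleCat.hom_ext <| LinearMap.ext
    hfg.apply_apply_eq_zero)

theorem adShortComplex_shortExact {f : M →ₗ[k] N} {g : N →ₗ[k] P} (hf : IsBimoduleHom A f)
    (hg : IsBimoduleHom A g) (hf' : Function.Injective f) (hg' : Function.Surjective g)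
    (hfg : Function.Exact f g) : (adShortComplex hf hg hfg).ShortExact where
  exact := (ShortComplex.ShortExact.moduleCat_exact_iff_function_exact _).2 hfg
  mono_f := (ModuleCat.mono_iff_injective _).2 hf'
  epi_g := (ModuleCat.epi_iff_surjective _).2 hg'

/-! ### Sweedler calculus -/

/-- In Sweedler notation, `∑ x₁ ⊗ T(x₂) U(x₃) = ∑ x₁ ⊗ ε(x₂) = x ⊗ 1` whenever the convolution
product `T * U` is trivial. It is used with the antipode and the identity as `T` and `U`, in either
order. -/
theorem sum_tmul_mul_eq_of_convolution (T U : A →ₗ[k] A)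
    (h : ∀ y : A, LinearMap.mul' k A (TensorProduct.map T U (comul (R := k) y)) =
      algebraMap k A (counit (R := k) y)) (x : A) :
    (LinearMap.mul' k A ∘ₗ TensorProduct.map T U).lTensor A
      ((comul (R := k)).lTensor A (comul (R := k) x)) = x ⊗ₜ[k] 1 := by
  have : LinearMap.mul' k A ∘ₗ TensorProduct.map T U ∘ₗ comul (R := k) =
      (Algebra.linearMap k A) ∘ₗ counit (R := k) := LinearMap.ext h
  rw [← LinearMap.lTensor_comp_apply, LinearMap.comp_assoc, this, LinearMap.lTensor_comp_apply,
    lTensor_counit_comul]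
  simp

theorem sum_comul_tmul_eq {x : A} (r : Repr k x (A × A))
    (l : ∀ i, Repr k (r.left i) (A × A)) :
    ∑ i ∈ r.index, ∑ j ∈ (l i).index, (l i).left j ⊗ₜ[k] ((l i).right j ⊗ₜ[k] r.right i) =
      (comul (R := k)).lTensor A (comul (R := k) x) := by
  rw [sum_tmul_tmul_eq r l (fun i => Repr.arbitrary k (r.right i)), ← r.eq]
  simp [← (Repr.arbitrary k (r.right _)).eq, TensorProduct.tmul_sum]

theorem mul_map_antipode_id (y : A) :
    LinearMap.mul' k A (TensorProduct.map (antipode k) LinearMap.id (comul (R := k) y)) =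
      algebraMap k A (counit (R := k) y) := mul_antipode_rTensor_comul_apply y

theorem mul_map_id_antipode (y : A) :
    LinearMap.mul' k A (TensorProduct.map LinearMap.id (antipode k) (comul (R := k) y)) =
      algebraMap k A (counit (R := k) y) := mul_antipode_lTensor_comul_apply y

/-- An element of a bimodule is invariant under the adjoint action if and only if it is central. -/
theorem adAction_eq_counit_smul_iff (m : M) :
    (∀ a : A, adAction k A M a m = counit (R := k) a • m) ↔
      ∀ a : A, a • m = MulOpposite.op a • m := by
  constructor
  -- The computation is `a m = ∑ a₁ m S(a₂) a₃ = ∑ ε(a₁) m a₂ = m a`, with invariance applied to the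
  -- first two legs.
  · intro h a
    let r := Repr.arbitrary k a
    let l := fun i => Repr.arbitrary k (r.left i)
    let act : A ⊗[k] A →ₗ[k] M := TensorProduct.lift
      ((LinearMap.lcomp k M (M := A) ((rightMul k A M).flip m)) ∘ₗ leftMul k A M)
    have key := congrArg act (sum_tmul_mul_eq_of_convolution (antipode k) LinearMap.id
      mul_map_antipode_id a)
    rw [← sum_comul_tmul_eq r l] at key
    simp only [map_sum, LinearMap.lTensor_tmul, LinearMap.comp_apply, TensorProduct.map_tmul,
      LinearMap.mul'_apply, act, TensorProduct.lift.tmul, LinearMap.lcomp_apply,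
      LinearMap.flip_apply, rightMul_apply, leftMul_apply, LinearMap.id_apply,
      MulOpposite.op_one, one_smul, MulOpposite.op_mul, mul_smul] at key
    rw [← key]
    have : ∀ i, ∑ j ∈ (l i).index, (l i).left j • MulOpposite.op (r.right i) •
        MulOpposite.op (antipode k ((l i).right j)) • m =
          counit (R := k) (r.left i) • MulOpposite.op (r.right i) • m := fun i => by
      rw [smul_comm, ← h, adAction_apply _ _ (l i), Finset.smul_sum]
      exact Finset.sum_congr rfl fun j _ => smul_comm _ _ _
    simp only [this]
    have := congrArg (fun x => (rightMul k A M).flip m x) (sum_counit_smul r)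
    simpa only [map_sum, map_smul, LinearMap.flip_apply, rightMul_apply] using this
  -- Conversely, `∑ a₁ m S(a₂) = ∑ m a₁ S(a₂) = ε(a) m`.
  · intro h a
    let r := Repr.arbitrary k a
    have := congrArg (fun x => (rightMul k A M).flip m x) (sum_mul_antipode_eq_smul r)
    simp only [map_sum, map_smul, LinearMap.flip_apply, rightMul_apply, MulOpposite.op_mul,
      mul_smul, MulOpposite.op_one, one_smul] at this
    rw [← this, adAction_apply _ _ r]
    exact Finset.sum_congr rfl fun i _ => by rw [smul_comm, h]

/-! ### The adjoint module of a coinduced bimodule -/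

variable (k A M) in
/-- The map `x ⊗ y ↦ (f ↦ f(x) y)`. -/
def coindPairing : A ⊗[k] A →ₗ[k] Coind k A M →ₗ[k] M :=
  TensorProduct.lift (LinearMap.mk₂ k (fun x y => rightMul k A M y ∘ₗ Coind.eval k A M x)
    (fun _ _ _ => by ext; simp) (fun _ _ _ => by ext; simp) (fun _ _ _ => by ext; simp)
    (fun _ _ _ => by ext; simp))

@[simp] theorem coindPairing_tmul (x y : A) (f : Coind k A M) :
    coindPairing k A M (x ⊗ₜ y) f = MulOpposite.op y • f x := rfl

variable (M) in
/-- The map `f ↦ (x ↦ ∑ f(x₁) T(x₂))`. -/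
def coindTwist (T : A →ₗ[k] A) : Coind k A M →ₗ[k] Coind k A M :=
  (coindPairing k A M ∘ₗ T.lTensor A ∘ₗ comul (R := k)).flip

theorem coindTwist_eq_pairing (T : A →ₗ[k] A) (f : Coind k A M) (x : A) :
    coindTwist M T f x = coindPairing k A M (T.lTensor A (comul (R := k) x)) f := rfl

theorem coindTwist_apply (T : A →ₗ[k] A) (f : Coind k A M) (x : A) {ι : Type*} (r : Repr k x ι) :
    coindTwist M T f x = ∑ i ∈ r.index, MulOpposite.op (T (r.right i)) • f (r.left i) := by
  rw [coindTwist_eq_pairing, ← r.eq]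
  simp

/-- The composite sends `f` to `x ↦ ∑ f(x₁) T(x₂) U(x₃)`, in which the last two factors contract to
the counit. -/
theorem coindTwist_coindTwist (T U : A →ₗ[k] A)
    (h : ∀ y : A, LinearMap.mul' k A (TensorProduct.map T U (comul (R := k) y)) =
      algebraMap k A (counit (R := k) y)) (f : Coind k A M) :
    coindTwist M U (coindTwist M T f) = f := by
  ext x
  let r := Repr.arbitrary k x
  let l := fun i => Repr.arbitrary k (r.left i)
  have key := congrArg (fun z => coindPairing k A M z f)
    (sum_tmul_mul_eq_of_convolution T U h x)
  rw [← sum_comul_tmul_eq r l] at key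
  simp only [map_sum, LinearMap.lTensor_tmul, LinearMap.comp_apply, TensorProduct.map_tmul,
    LinearMap.sum_apply, LinearMap.mul'_apply, coindPairing_tmul,
    MulOpposite.op_one, one_smul, MulOpposite.op_mul, mul_smul] at key
  rw [coindTwist_apply U _ x r]
  simp only [coindTwist_apply T f _ (l _), Finset.smul_sum]
  exact key

/-- Both sides at `x` equal `∑ f(x₁ a₁) S(a₂) S(x₂)`: the comultiplication is multiplicative and `S`
reverses products. -/
theorem coindTwist_antipode_adAction (a : A) (f : Coind k A M) :
    coindTwist M (antipode k) (adAction k A _ a f) = a • coindTwist M (antipode k) f := by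
  ext x
  let r := Repr.arbitrary k x
  let s := Repr.arbitrary k a
  have key : (comul (R := k) (x * a)) = ∑ i ∈ r.index, ∑ j ∈ s.index,
      (r.left i * s.left j) ⊗ₜ (r.right i * s.right j) := by
    rw [Bialgebra.comul_mul, ← r.eq, ← s.eq, Finset.sum_mul_sum]
    simp
  rw [Coind.left_smul_apply, coindTwist_apply _ _ x r, adAction_apply a f s,
    coindTwist_eq_pairing, key]
  simp only [map_sum, LinearMap.sum_apply, LinearMap.lTensor_tmul, coindPairing_tmul,
    antipode_mul_antidistrib, MulOpposite.op_mul, mul_smul, coind_sum_apply, Coind.left_smul_apply, Coind.op_smul_apply, Finset.smul_sum]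

theorem bijective_coindTwist_antipode :
    Function.Bijective (coindTwist M (antipode k : A →ₗ[k] A)) :=
  Function.bijective_iff_has_inverse.2 ⟨coindTwist M LinearMap.id,
    coindTwist_coindTwist _ _ mul_map_antipode_id, coindTwist_coindTwist _ _ mul_map_id_antipode⟩

variable (k A M) in
/-- The adjoint module of a coinduced bimodule is a coinduced module. -/
def adCoindEquiv : Ad k A (Coind k A M) ≃ₗ[A] Coind k A M :=
  LinearEquiv.ofBijective
    (Ad.desc (coindTwist M (antipode k)) coindTwist_antipode_adAction) bijective_coindTwist_antipode

/-- Evaluation at `1` makes `A`-linear maps into `Hom_k(A, M)` correspond to `k`-linear maps into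
`M`, and over a field these extend along any injection. The extension built from the `k`-linear map
`e` is `y ↦ (x ↦ e(x y))`. -/
theorem injective_coind : CategoryTheory.Injective (ModuleCat.of A (Coind k A M)) where
  factors {X Y} g f hf := by
    let _ : Module k X := Module.restrictScalars k A X
    let _ : Module k Y := Module.restrictScalars k A Y
    have _ : IsScalarTower k A X := IsScalarTower.restrictScalars k A X
    have _ : IsScalarTower k A Y := IsScalarTower.restrictScalars k A Y
    obtain ⟨s, hs⟩ := (f.hom.restrictScalars k).exists_leftInverse_of_injective
      (LinearMap.ker_eq_bot.2 ((ModuleCat.mono_iff_injective f).1 hf))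
    let e : Y →ₗ[k] M := Coind.eval k A M 1 ∘ₗ g.hom.restrictScalars k ∘ₗ s
    refine ⟨ModuleCat.ofHom (Y := Coind k A M)
      { toFun y := e ∘ₗ (LinearMap.toSpanSingleton A Y y).restrictScalars k
        map_add' y z := Coind.ext fun x => ?_
        map_smul' a y := Coind.ext fun x => ?_ }, ?_⟩
    · change e (x • (y + z)) = e (x • y) + e (x • z)
      rw [smul_add, map_add]
    · change e (x • a • y) = e ((x * a) • y)
      rw [mul_smul]
    · refine ModuleCat.hom_ext (LinearMap.ext fun y => Coind.ext fun x => ?_)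
      change g.hom (s (x • f.hom y)) 1 = g.hom y x
      have h : s (f.hom (x • y)) = x • y := LinearMap.congr_fun hs _
      rw [← map_smul, h, map_smul,
        Coind.left_smul_apply, one_mul]

instance injective_adModule_coind :
    CategoryTheory.Injective (adModule k A (Coind k A M)) :=
  Injective.of_iso (adCoindEquiv k A M).symm.toModuleIso injective_coind

/-! ### The adjoint module of an induced bimodule -/

variable (k A M) in
/-- The map `x ⊗ y ↦ (m ↦ x ⊗ m y)`. -/
def indPairing : A ⊗[k] A →ₗ[k] M →ₗ[k] Ind k A M :=
  TensorProduct.lift (LinearMap.mk₂ k (fun x y => Ind.mk k A M x ∘ₗ rightMul k A M y)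
    (fun _ _ _ => by ext; simp) (fun _ _ _ => by ext; simp) (fun _ _ _ => by ext; simp)
    (fun _ _ _ => by ext; simp))

@[simp] theorem indPairing_tmul (x y : A) (m : M) :
    indPairing k A M (x ⊗ₜ y) m = Ind.mk k A M x (MulOpposite.op y • m) := rfl

variable (M) in
/-- The map `x ⊗ m ↦ ∑ x₁ ⊗ m T(x₂)`. -/
def indTwist (T : A →ₗ[k] A) : Ind k A M →ₗ[k] Ind k A M :=
  Ind.lift k (indPairing k A M ∘ₗ T.lTensor A ∘ₗ comul (R := k))

theorem indTwist_mk (T : A →ₗ[k] A) (x : A) (m : M) {ι : Type*} (r : Repr k x ι) :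
    indTwist M T (Ind.mk k A M x m) =
      ∑ i ∈ r.index, Ind.mk k A M (r.left i) (MulOpposite.op (T (r.right i)) • m) := by
  rw [indTwist, Ind.lift_mk, LinearMap.comp_apply, LinearMap.comp_apply, ← r.eq]
  simp

/-- The composite sends `x ⊗ m` to `∑ x₁ ⊗ m T(x₃) U(x₂)`. The legs come out in reverse order, so
the condition concerns `∑ T(y₂) U(y₁)` and not an ordinary convolution. -/
theorem indTwist_indTwist (T U : A →ₗ[k] A)
    (h : ∀ y : A, LinearMap.mul' k A (TensorProduct.comm k A A
      (TensorProduct.map U T (comul (R := k) y))) = algebraMap k A (counit (R := k) y))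
    (t : Ind k A M) : indTwist M U (indTwist M T t) = t := by
  induction t using Ind.induction with
  | zero => simp
  | add s t hs ht => rw [map_add, map_add, hs, ht]
  | mk x m =>
    let r := Repr.arbitrary k x
    let l := fun i => Repr.arbitrary k (r.left i)
    have h' : LinearMap.mul' k A ∘ₗ (TensorProduct.comm k A A).toLinearMap ∘ₗ
        TensorProduct.map U T ∘ₗ comul (R := k) = Algebra.linearMap k A ∘ₗ counit (R := k) :=
      LinearMap.ext h
    have key : (LinearMap.mul' k A ∘ₗ (TensorProduct.comm k A A).toLinearMap ∘ₗ
        TensorProduct.map U T).lTensor A ((comul (R := k)).lTensor A (comul (R := k) x)) =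
          x ⊗ₜ[k] 1 := by
      rw [← LinearMap.lTensor_comp_apply, LinearMap.comp_assoc, LinearMap.comp_assoc, h',
        LinearMap.lTensor_comp_apply, lTensor_counit_comul]
      simp
    rw [← sum_comul_tmul_eq r l] at key
    replace key := congrArg (fun z => indPairing k A M z m) key
    simp only [map_sum, LinearMap.sum_apply, LinearMap.lTensor_tmul, LinearMap.comp_apply,
      TensorProduct.map_tmul, LinearEquiv.coe_coe, TensorProduct.comm_tmul, LinearMap.mul'_apply,
      indPairing_tmul, MulOpposite.op_mul, mul_smul, MulOpposite.op_one, one_smul] at key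
    rw [indTwist_mk T x m r, map_sum]
    simp only [indTwist_mk U _ _ (l _)]
    exact key

/-- On `x ⊗ m` both sides are `∑ a₁ x₁ ⊗ m S(x₂) S(a₂)`. -/
theorem indTwist_antipode_smul (a : A) (t : Ind k A M) :
    indTwist M (antipode k) (a • t) = adAction k A _ a (indTwist M (antipode k) t) := by
  induction t using Ind.induction with
  | zero => simp
  | add s t hs ht => rw [smul_add, map_add, map_add, map_add, hs, ht]
  | mk x m =>
    let r := Repr.arbitrary k x
    let s := Repr.arbitrary k a
    have key : (comul (R := k) (a * x)) = ∑ j ∈ s.index, ∑ i ∈ r.index,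
        (s.left j * r.left i) ⊗ₜ (s.right j * r.right i) := by
      rw [Bialgebra.comul_mul, ← r.eq, ← s.eq, Finset.sum_mul_sum]
      simp
    rw [Ind.smul_mk, indTwist_mk _ x m r, adAction_apply _ _ s, indTwist, Ind.lift_mk,
      LinearMap.comp_apply, LinearMap.comp_apply, key]
    simp only [map_sum, LinearMap.sum_apply, LinearMap.lTensor_tmul, indPairing_tmul,
      antipode_mul_antidistrib, MulOpposite.op_mul, mul_smul, Finset.smul_sum, Ind.smul_mk,
      Ind.op_smul_mk]

theorem antipode_algebraMap (c : k) :
    antipode k (algebraMap k A c : A) = algebraMap k A c := by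
  rw [Algebra.algebraMap_eq_smul_one, map_smul, antipode_one]

/-- The reversed legs force `S²`, not the identity, into the inverse: `∑ S²(y₂) S(y₁) = S(∑ y₁
S(y₂)) = ε(y)`. -/
theorem indTwist_antipode_indTwist (t : Ind k A M) :
    indTwist M (antipode k) (indTwist M (antipode k ∘ₗ antipode k) t) = t := by
  refine indTwist_indTwist _ _ (fun y => ?_) t
  have := congrArg (antipode k) (mul_map_id_antipode (k := k) y)
  rw [antipode_algebraMap] at this
  rw [← this, ← (Repr.arbitrary k y).eq]
  simp [antipode_mul_antidistrib]

theorem indTwist_indTwist_antipode (t : Ind k A M) :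
    indTwist M (antipode k ∘ₗ antipode k) (indTwist M (antipode k) t) = t := by
  refine indTwist_indTwist _ _ (fun y => ?_) t
  have := congrArg (antipode k) (mul_map_antipode_id (k := k) y)
  rw [antipode_algebraMap] at this
  rw [← this, ← (Repr.arbitrary k y).eq]
  simp [antipode_mul_antidistrib]

theorem bijective_indTwist_antipode :
    Function.Bijective (indTwist M (antipode k : A →ₗ[k] A)) :=
  Function.bijective_iff_has_inverse.2 ⟨indTwist M (antipode k ∘ₗ antipode k),
    indTwist_indTwist_antipode, indTwist_antipode_indTwist⟩

variable (k A M) in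
/-- The adjoint module of an induced bimodule is an induced module. -/
def adIndEquiv : Ind k A M ≃ₗ[A] Ad k A (Ind k A M) :=
  LinearEquiv.ofBijective
    (Ad.lift (indTwist M (antipode k)) indTwist_antipode_smul) bijective_indTwist_antipode

/-- The action on `A ⊗ M` involves only the first factor, so a `k`-basis of `M` gives an `A`-basis.
-/
instance free_ind : Module.Free A (Ind k A M) :=
  inferInstanceAs (Module.Free A (A ⊗[k] M))

instance free_ad_ind : Module.Free A (Ad k A (Ind k A M)) := Module.Free.of_equiv (adIndEquiv k A M)

end Adjoint

/-! ### Extensions of finitely generated modules by free modules -/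

section ExtFree

variable {A : Type u} [Ring A]

theorem ext_comp_mk₀_sum {C : Type*} [Category C] [Abelian C] [HasExt C] {X Y Z : C} {n : ℕ}
    {ι : Type*} (s : Finset ι) (f : ι → (Y ⟶ Z)) (x : Ext X Y n) :
    x.comp (Ext.mk₀ (∑ i ∈ s, f i)) (add_zero n) =
      ∑ i ∈ s, x.comp (Ext.mk₀ (f i)) (add_zero n) := by
  classical
  induction s using Finset.induction_on with
  | empty => simp
  | insert i s hi ih =>
    rw [Finset.sum_insert hi, Finset.sum_insert hi, Ext.mk₀_add, Ext.comp_add, ih]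

/-- The coordinate projections of a free module. -/
def freeCoord (I : Type u) (i : I) : ModuleCat.of A (I →₀ A) ⟶ ModuleCat.of A A :=
  ModuleCat.ofHom (Finsupp.lapply i)

/-- The coordinate inclusions of a free module. -/
def freeIncl (I : Type u) (i : I) : ModuleCat.of A A ⟶ ModuleCat.of A (I →₀ A) :=
  ModuleCat.ofHom (Finsupp.lsingle i)

/-- The images of finitely many generators have finite supports, and projecting onto the union of
those supports fixes `f`. -/
theorem ext_mk₀_comp_finset_sum_eq {I : Type u} {X : ModuleCat.{u} A} [Module.Finite A X]
    (f : X ⟶ ModuleCat.of A (I →₀ A)) :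
    ∃ s : Finset I, f ≫ ∑ i ∈ s, freeCoord I i ≫ freeIncl I i = f := by
  classical
  obtain ⟨S, hS⟩ := (Module.finite_def.1 ‹Module.Finite A X›)
  refine ⟨S.biUnion fun x => (f.hom x).support, ModuleCat.hom_ext ?_⟩
  refine LinearMap.ext_on hS fun x hx => ?_
  have h : (∑ i ∈ S.biUnion fun x => (f.hom x).support,
      freeCoord (A := A) I i ≫ freeIncl I i).hom (f.hom x) =
        ∑ i ∈ S.biUnion fun x => (f.hom x).support, Finsupp.single i (f.hom x i) := by
    rw [ModuleCat.hom_sum, LinearMap.sum_apply]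
    rfl
  refine Eq.trans h ?_
  conv_rhs => rw [← Finsupp.sum_single (f.hom x)]
  refine (Finset.sum_subset (fun i hi => Finset.mem_biUnion.2 ⟨x, hx, hi⟩) fun i _ hi => ?_).symm
  rw [Finsupp.notMem_support_iff.1 hi, Finsupp.single_zero]

/-- Over a left noetherian ring, an extension of a finitely generated module by a free module is
supported on finitely many coordinates. -/
theorem ext_eq_sum_coord [IsNoetherianRing A] (I : Type u) (n : ℕ) (X : ModuleCat.{u} A)
    [Module.Finite A X] (x : Ext X (ModuleCat.of A (I →₀ A)) n) :
    ∃ s : Finset I, x.comp (Ext.mk₀ (∑ i ∈ s, freeCoord I i ≫ freeIncl I i)) (add_zero n) = x := by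
  induction n generalizing X with
  | zero =>
    obtain ⟨f, rfl⟩ := Ext.mk₀_bijective _ _ |>.2 x
    obtain ⟨s, hs⟩ := ext_mk₀_comp_finset_sum_eq f
    exact ⟨s, by rw [Ext.mk₀_comp_mk₀, hs]⟩
  | succ n ih =>
    obtain ⟨m, p, hp⟩ := Module.Finite.exists_fin' A X
    let S : ShortComplex (ModuleCat.{u} A) := ShortComplex.mk
      (ModuleCat.ofHom (LinearMap.ker p).subtype) (ModuleCat.ofHom p)
      (ModuleCat.hom_ext (LinearMap.ext fun y => y.2))
    have hS : S.ShortExact :=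
      { exact := (ShortComplex.ShortExact.moduleCat_exact_iff_function_exact _).2
          (LinearMap.exact_subtype_ker_map p)
        mono_f := (ModuleCat.mono_iff_injective _).2 Subtype.val_injective
        epi_g := (ModuleCat.epi_iff_surjective _).2 hp }
    have hP : Projective (ModuleCat.of A (Fin m → A)) :=
      (IsProjective.iff_projective _).1 inferInstance
    -- Since `Fin m → A` is projective, `x` comes from a class one degree lower on the kernel of
    -- `p`. That kernel is finitely generated because `A` is noetherian, so the induction applies to
    -- it.
    obtain ⟨y, hy⟩ := Ext.contravariant_sequence_exact₃ hS _ x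
      (@Ext.eq_zero_of_projective _ _ _ _ _ _ _ hP _) (add_comm 1 n)
    have : Module.Finite A (ModuleCat.of A (LinearMap.ker p)) :=
      inferInstanceAs (Module.Finite A (LinearMap.ker p))
    obtain ⟨s, hs⟩ := ih (ModuleCat.of A (LinearMap.ker p)) y
    refine ⟨s, ?_⟩
    rw [← hy, Ext.comp_assoc_of_third_deg_zero]
    exact congrArg (fun z => hS.extClass.comp z (add_comm 1 n)) hs

/-- A class supported on finitely many coordinates is a finite sum of classes, each factoring
through `Ext^n(X, A) = 0`. -/
theorem ext_free_eq_zero [IsNoetherianRing A] (X : ModuleCat.{u} A) [Module.Finite A X] (n : ℕ)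
    [Subsingleton (Ext X (ModuleCat.of A A) n)] (I : Type u)
    (x : Ext X (ModuleCat.of A (I →₀ A)) n) : x = 0 := by
  obtain ⟨s, hs⟩ := ext_eq_sum_coord I n X x
  rw [← hs, ext_comp_mk₀_sum]
  refine Finset.sum_eq_zero fun i _ => ?_
  rw [← Ext.mk₀_comp_mk₀, ← Ext.comp_assoc_of_third_deg_zero,
    Subsingleton.elim (x.comp (Ext.mk₀ (freeCoord I i)) (add_zero n)) 0, Ext.zero_comp]

theorem subsingleton_ext_of_free [IsNoetherianRing A] (X : ModuleCat.{u} A) [Module.Finite A X]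
    (n : ℕ) [Subsingleton (Ext X (ModuleCat.of A A) n)] (N : Type u) [AddCommGroup N] [Module A N]
    [Module.Free A N] : Subsingleton (Ext X (ModuleCat.of A N) n) := by
  refine subsingleton_of_forall_eq 0 fun x => ?_
  let e := (Module.Free.chooseBasis A N).repr.toModuleIso
  have h := ext_free_eq_zero X n _ (x.comp (Ext.mk₀ e.hom) (add_zero n))
  have := congrArg (fun y => y.comp (Ext.mk₀ e.inv) (add_zero n)) h
  simpa [Ext.comp_assoc_of_third_deg_zero] using this

end ExtFree

/-! ### The top extension group as a space of coinvariants -/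

section TopExt

variable {k A : Type u} [Field k] [Ring A] [Algebra k A]

variable (π : A →ₐ[k] k) (N : Type u) [AddCommGroup N] [Module k N] [Module A N]
  [IsScalarTower k A N] (N' : Type u) [AddCommGroup N'] [Module k N'] [Module A N']
  [IsScalarTower k A N']

/-- The submodule of `N` spanned by the elements `a n - π(a) n`. -/
def characterRelations : Submodule k N :=
  Submodule.span k {x | ∃ (a : A) (n : N), x = a • n - π a • n}

variable {N N'}

theorem sub_mem_characterRelations (a : A) (n : N) : a • n - π a • n ∈ characterRelations π N :=
  Submodule.subset_span ⟨a, n, rfl⟩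

theorem map_mem_characterRelations (f : N →ₗ[A] N') {n : N} (hn : n ∈ characterRelations π N) :
    f n ∈ characterRelations π N' := by
  have : characterRelations π N ≤ (characterRelations π N').comap (f.restrictScalars k) := by
    refine Submodule.span_le.2 ?_
    rintro _ ⟨a, n, rfl⟩
    have : f (a • n - π a • n) = a • f n - π a • f n := by
      rw [map_sub, map_smul]
      exact congrArg _ ((f.restrictScalars k).map_smul _ _)
    change f _ ∈ characterRelations π N'
    rw [this]
    exact sub_mem_characterRelations π a (f n)
  exact this hn

variable {X : ModuleCat.{u} A} {d : ℕ} {e : Ext X (ModuleCat.of A A) d}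
  (he : ∀ a : A, e.comp (Ext.mk₀ (rightMulHom a)) (add_zero d) = π a • e)

/-- The morphism `a ↦ a n`. -/
abbrev spanHom (n : N) : ModuleCat.of A A ⟶ ModuleCat.of A N :=
  ModuleCat.ofHom (LinearMap.toSpanSingleton A N n)

theorem spanHom_smul (a : A) (n : N) : spanHom (a • n) = rightMulHom a ≫ spanHom n := by
  ext
  simp [rightMulHom, spanHom]

theorem spanHom_comp (f : N →ₗ[A] N') (n : N) :
    spanHom (A := A) n ≫ ModuleCat.ofHom f = spanHom (f n) := by
  ext
  simp [spanHom]

variable (N) in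
include he in
theorem comp_spanHom_smul (a : A) (n : N) :
    e.comp (Ext.mk₀ (spanHom (a • n))) (add_zero d) =
      π a • e.comp (Ext.mk₀ (spanHom n)) (add_zero d) := by
  rw [spanHom_smul, ← Ext.mk₀_comp_mk₀, ← Ext.comp_assoc_of_third_deg_zero, he, Ext.smul_comp]

variable (N) in
/-- The map `N → Ext^d(X, N)` which pushes a class `e` in `Ext^d(X, A)`, on which `A` acts by the
character `π`, along the maps `a ↦ a n`. -/
def topExtMap : N →ₗ[k] Ext X (ModuleCat.of A N) d where
  toFun n := e.comp (Ext.mk₀ (spanHom n)) (add_zero d)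
  map_add' m n := by
    have : spanHom (A := A) (m + n) = spanHom m + spanHom n := by
      ext
      simp [spanHom]
    rw [this, Ext.mk₀_add, Ext.comp_add]
  map_smul' c n := by
    -- Scalars act through `A` and `π` fixes them, so `k`-linearity is a special case of
    -- equivariance under `π`.
    rw [← algebraMap_smul A c n, comp_spanHom_smul π N he]
    simp

theorem topExtMap_apply (n : N) :
    topExtMap π N he n = e.comp (Ext.mk₀ (spanHom n)) (add_zero d) := rfl

theorem topExtMap_naturality (f : N →ₗ[A] N') (n : N) :
    (topExtMap π N he n).comp (Ext.mk₀ (ModuleCat.ofHom f)) (add_zero d) =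
      topExtMap π N' he (f n) := by
  rw [topExtMap_apply, topExtMap_apply, Ext.comp_assoc_of_third_deg_zero, Ext.mk₀_comp_mk₀,
    spanHom_comp]

theorem characterRelations_le_ker_topExtMap :
    characterRelations π N ≤ LinearMap.ker (topExtMap π N he) := by
  refine Submodule.span_le.2 ?_
  rintro _ ⟨a, n, rfl⟩
  change topExtMap π N he _ = 0
  rw [map_sub, sub_eq_zero]
  exact (comp_spanHom_smul π N he a n).trans ((topExtMap π N he).map_smul (π a) n).symm

theorem topExtMap_self (a : A) : topExtMap π A he a = π a • e := by
  rw [← he]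
  rfl

variable (hspan : ∀ x : Ext X (ModuleCat.of A A) d, ∃ c : k, x = c • e)

-- Only finitely many coordinates of a class matter, and each is a multiple `c i • e`, which is the
-- image of `c i` times a basis vector.
include hspan in
theorem topExtMap_finsupp_surjective [IsNoetherianRing A] [Module.Finite A X] (I : Type u) :
    Function.Surjective (topExtMap π (I →₀ A) he) := fun x => by
  obtain ⟨s, hs⟩ := ext_eq_sum_coord I d X x
  choose c hc using fun i => hspan (x.comp (Ext.mk₀ (freeCoord I i)) (add_zero d))
  refine ⟨∑ i ∈ s, c i • Finsupp.single i 1, ?_⟩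
  rw [map_sum, ← hs, ext_comp_mk₀_sum]
  refine Finset.sum_congr rfl fun i _ => ?_
  rw [← Ext.mk₀_comp_mk₀, ← Ext.comp_assoc_of_third_deg_zero, hc, map_smul, Ext.smul_comp,
    topExtMap_apply]
  congr 3
  ext
  simp [freeIncl, spanHom]

/-- Projecting to a coordinate gives `π(f i) e = 0`, hence `π(f i) = 0`. Each summand of `f` is then
the relation attached to `f i` and the basis vector at `i`. -/
theorem ker_topExtMap_finsupp_le (he0 : e ≠ 0) (I : Type u) :
    LinearMap.ker (topExtMap π (I →₀ A) he) ≤ characterRelations π (I →₀ A) := fun f hf => by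
  have h : ∀ i, π (f i) = 0 := fun i => by
    have := topExtMap_naturality π he (Finsupp.lapply i : (I →₀ A) →ₗ[A] A) f
    rw [LinearMap.mem_ker.1 hf, Ext.zero_comp, topExtMap_self, eq_comm, smul_eq_zero] at this
    exact this.resolve_right he0
  rw [← Finsupp.sum_single f]
  refine Submodule.sum_mem _ fun i _ => ?_
  have := sub_mem_characterRelations π (f i) (Finsupp.single i (1 : A))
  simpa [h i] using this

section Presentation

variable (A N) in
/-- The canonical presentation of `N` by the free module on the set `N`. -/
abbrev presentationMap : (N →₀ A) →ₗ[A] N := Finsupp.linearCombination A id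

theorem presentationMap_surjective : Function.Surjective (presentationMap A N) :=
  Finsupp.linearCombination_id_surjective A N

variable (A N) in
/-- The short exact sequence `0 → K → A^(N) → N → 0`. -/
abbrev presentation : ShortComplex (ModuleCat.{u} A) :=
  ShortComplex.mk (X₁ := ModuleCat.of A (LinearMap.ker (presentationMap A N)))
    (X₂ := ModuleCat.of A (N →₀ A)) (X₃ := ModuleCat.of A N)
    (ModuleCat.ofHom (LinearMap.ker (presentationMap A N)).subtype)
    (ModuleCat.ofHom (presentationMap A N)) (ModuleCat.hom_ext (LinearMap.ext fun y => y.2))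

variable (A N) in
theorem presentation_shortExact : (presentation A N).ShortExact where
  exact := (ShortComplex.ShortExact.moduleCat_exact_iff_function_exact _).2
    (LinearMap.exact_subtype_ker_map _)
  mono_f := (ModuleCat.mono_iff_injective _).2 Subtype.val_injective
  epi_g := (ModuleCat.epi_iff_surjective _).2 presentationMap_surjective

end Presentation

variable [IsNoetherianRing A] [Module.Finite A X] [HasProjectiveDimensionLT X (d + 1)]

-- As `Ext^{d+1}(X, -)` vanishes, classes lift along `A^(N) → N`, which reduces the claim to free
-- modules.
variable (N) in
include hspan in
theorem topExtMap_surjective : Function.Surjective (topExtMap π N he) := fun x => by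
  obtain ⟨y, hy⟩ := Ext.covariant_sequence_exact₃ X (presentation_shortExact A N) x rfl
    (Ext.eq_zero_of_hasProjectiveDimensionLT _ (d + 1) le_rfl)
  obtain ⟨f, rfl⟩ := topExtMap_finsupp_surjective π he hspan N y
  exact ⟨presentationMap A N f, by rw [← hy, topExtMap_naturality]⟩

-- A chase in the presentation `0 → K → A^(N) → N → 0`. If `f` maps to zero over `N`, its class
-- comes from `K`, and by surjectivity for `K` from an element `g` of `K`. Then `g - f` is killed
-- over the free module, so it lies in the relations there, and its image in `N` is `-n`.
variable (N) in
include hspan in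
theorem ker_topExtMap (he0 : e ≠ 0) :
    LinearMap.ker (topExtMap π N he) = characterRelations π N := by
  refine le_antisymm (fun n hn => ?_) (characterRelations_le_ker_topExtMap π he)
  obtain ⟨f, rfl⟩ := presentationMap_surjective (A := A) n
  rw [LinearMap.mem_ker, ← topExtMap_naturality] at hn
  obtain ⟨y, hy⟩ := Ext.covariant_sequence_exact₂ X (presentation_shortExact A N) _ hn
  obtain ⟨g, rfl⟩ := topExtMap_surjective π (LinearMap.ker (presentationMap A N)) he hspan y
  rw [topExtMap_naturality, ← sub_eq_zero, ← map_sub] at hy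
  have h := map_mem_characterRelations π (presentationMap A N)
    (ker_topExtMap_finsupp_le π he he0 N hy)
  have hg : presentationMap A N (g : N →₀ A) = 0 := g.2
  rw [map_sub, Submodule.subtype_apply, hg, zero_sub] at h
  exact neg_mem_iff.1 h

end TopExt

/-! ### Dimension shifting for extension groups -/

section ExtShift

variable (k : Type u) [CommRing k] {C : Type*} [Category C] [Abelian C] [HasExt.{u} C] [Linear k C]
  (X : C) {S : ShortComplex C} (hS : S.ShortExact)

include hS in
theorem ext_succ_equiv_cokernel (n : ℕ) [Subsingleton (Ext X S.X₂ (n + 1))] :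
    Nonempty (Ext X S.X₁ (n + 1) ≃ₗ[k] Ext X S.X₃ n ⧸
      LinearMap.range ((Ext.mk₀ S.g).postcompOfLinear k X (add_zero n))) := by
  let δ : Ext X S.X₃ n →ₗ[k] Ext X S.X₁ (n + 1) := hS.extClass.postcompOfLinear k X rfl
  have hδ : Function.Surjective δ := fun x =>
    Ext.covariant_sequence_exact₁ X hS x (Subsingleton.elim _ _) rfl
  have hker : LinearMap.range ((Ext.mk₀ S.g).postcompOfLinear k X (add_zero n)) =
      LinearMap.ker δ := by
    ext x
    constructor
    · rintro ⟨y, rfl⟩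
      change (y.comp (Ext.mk₀ S.g) (add_zero n)).comp hS.extClass rfl = 0
      rw [Ext.comp_assoc_of_second_deg_zero, ShortComplex.ShortExact.comp_extClass, Ext.comp_zero]
    · exact fun hx => Ext.covariant_sequence_exact₃ X hS x rfl hx
  exact ⟨(Submodule.quotEquivOfEq _ _ hker ≪≫ₗ δ.quotKerEquivOfSurjective hδ).symm⟩

include hS in
theorem ext_equiv_ker (n : ℕ) [Subsingleton (Ext X S.X₂ n)] :
    Nonempty (Ext X S.X₃ n ≃ₗ[k]
      LinearMap.ker ((Ext.mk₀ S.f).postcompOfLinear k X (add_zero (n + 1)))) := by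
  let δ : Ext X S.X₃ n →ₗ[k] Ext X S.X₁ (n + 1) := hS.extClass.postcompOfLinear k X rfl
  have hδ : Function.Injective δ := by
    rw [← LinearMap.ker_eq_bot, LinearMap.ker_eq_bot']
    intro x hx
    obtain ⟨y, rfl⟩ := Ext.covariant_sequence_exact₃ X hS x rfl hx
    rw [Subsingleton.elim y 0, Ext.zero_comp]
  have hrange : LinearMap.range δ =
      LinearMap.ker ((Ext.mk₀ S.f).postcompOfLinear k X (add_zero (n + 1))) := by
    ext x
    constructor
    · rintro ⟨y, rfl⟩
      change (y.comp hS.extClass rfl).comp (Ext.mk₀ S.f) (add_zero (n + 1)) = 0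
      rw [Ext.comp_assoc_of_third_deg_zero, ShortComplex.ShortExact.extClass_comp, Ext.comp_zero]
    · exact fun hx => Ext.covariant_sequence_exact₁ X hS x hx rfl
  exact ⟨LinearEquiv.ofInjective δ hδ ≪≫ₗ LinearEquiv.ofEq _ _ hrange⟩

end ExtShift

/-! ### Hochschild cohomology as extensions of the trivial module -/

section Cohomology

variable {k A : Type u} [Field k] [Ring A] [HopfAlgebra k A]
variable {M N P : Type u}
  [AddCommGroup M] [Module k M] [Module A M] [Module Aᵐᵒᵖ M]
  [SMulCommClass A Aᵐᵒᵖ M] [IsScalarTower k A M] [IsScalarTower k Aᵐᵒᵖ M]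
  [AddCommGroup N] [Module k N] [Module A N] [Module Aᵐᵒᵖ N]
  [SMulCommClass A Aᵐᵒᵖ N] [IsScalarTower k A N] [IsScalarTower k Aᵐᵒᵖ N]

variable (k A) in
/-- The generator of the trivial module. -/
def trivialOne : trivialLeft k A := (1 : k)

theorem smul_trivialOne (a : A) :
    a • trivialOne k A = algebraMap k A (Coalgebra.counit (R := k) a) • trivialOne k A := by
  change Bialgebra.counitAlgHom k A a * 1 =
    Bialgebra.counitAlgHom k A (algebraMap k A (Coalgebra.counit (R := k) a)) * 1
  simp

theorem exists_smul_trivialOne_eq (x : trivialLeft k A) :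
    ∃ t : k, x = algebraMap k A t • trivialOne k A := by
  have h (t : k) : t = Bialgebra.counitAlgHom k A (algebraMap k A t) * 1 := by
    rw [AlgHom.commutes, mul_one, Algebra.algebraMap_self_apply]
  exact ⟨(x : k), h x⟩

theorem trivialHom_ext {X : ModuleCat.{u} A} {f g : trivialLeft k A ⟶ X}
    (h : f.hom (trivialOne k A) = g.hom (trivialOne k A)) : f = g := by
  refine ModuleCat.hom_ext (LinearMap.ext fun x => ?_)
  obtain ⟨t, rfl⟩ := exists_smul_trivialOne_eq x
  rw [map_smul, map_smul, h]

instance finite_trivialLeft : Module.Finite A (trivialLeft k A) :=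
  ⟨⟨{trivialOne k A}, Submodule.eq_top_iff'.2 fun x => by
    obtain ⟨t, rfl⟩ := exists_smul_trivialOne_eq x
    exact Submodule.smul_mem _ _ (Submodule.subset_span (by simp))⟩⟩

/-- The morphism from the trivial module given by an invariant element. -/
def trivialHom (m : M) (hm : ∀ a : A, adAction k A M a m = Coalgebra.counit (R := k) a • m) :
    trivialLeft k A ⟶ adModule k A M :=
  ModuleCat.ofHom (X := trivialLeft k A)
    { toFun := fun t : k => Ad.of k A M (t • m)
      map_add' := fun (s t : k) => by
        change Ad.of k A M ((s + t) • m) = _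
        rw [add_smul, map_add]
      map_smul' := fun (a : A) (t : k) => by
        change Ad.of k A M ((Coalgebra.counit (R := k) a * t) • m) = a • Ad.of k A M (t • m)
        rw [Ad.smul_of, (adAction k A M a).map_smul, hm, smul_smul, mul_comm] }

theorem trivialHom_trivialOne (m : M)
    (hm : ∀ a : A, adAction k A M a m = Coalgebra.counit (R := k) a • m) :
    (trivialHom m hm).hom (trivialOne k A) = Ad.of k A M m :=
  congrArg (Ad.of k A M) (one_smul k m)

theorem exists_trivialHom_eq (f : trivialLeft k A ⟶ adModule k A M) :
    ∃ (m : M) (hm : ∀ a : A, adAction k A M a m = Coalgebra.counit (R := k) a • m),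
      trivialHom m hm = f := by
  refine ⟨(Ad.of k A M).symm (f.hom (trivialOne k A)), fun a => ?_, trivialHom_ext ?_⟩
  · apply (Ad.of k A M).injective
    have h := congrArg f.hom (smul_trivialOne (k := k) a)
    rw [map_smul, map_smul, algebraMap_smul] at h
    rw [← Ad.smul_of, map_smul, LinearEquiv.apply_symm_apply]
    exact h
  · rw [trivialHom_trivialOne]
    rfl

variable (k A M) in
/-- The zeroth Hochschild cohomology as the space of morphisms from the trivial module to the
adjoint module. -/
def cocycleZeroToExt : hochschildCocycles k A M 0 →ₗ[k]
    Ext (trivialLeft k A) (adModule k A M) 0 where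
  toFun c := Ext.mk₀ (trivialHom (c.1 ![]) ((adAction_eq_counit_smul_iff _).2
    ((mem_hochschildCocycles_zero c.1).1 c.2)))
  map_add' c c' := by
    rw [← Ext.mk₀_add]
    congr 1
    refine trivialHom_ext ?_
    rw [trivialHom_trivialOne, ModuleCat.hom_add, LinearMap.add_apply, trivialHom_trivialOne,
      trivialHom_trivialOne, ← map_add]
    rfl
  map_smul' t c := by
    rw [← Ext.mk₀_smul]
    congr 1
    refine trivialHom_ext ?_
    rw [trivialHom_trivialOne]
    change _ = algebraMap k A t • (trivialHom (c.1 ![]) _).hom (trivialOne k A)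
    rw [trivialHom_trivialOne, algebraMap_smul]
    rfl

theorem bijective_cocycleZeroToExt : Function.Bijective (cocycleZeroToExt k A M) := by
  constructor
  · intro c c' h
    have h' := congrArg (fun f => f.hom (trivialOne k A)) (Ext.mk₀_bijective _ _ |>.1 h)
    dsimp only at h'
    rw [trivialHom_trivialOne, trivialHom_trivialOne] at h'
    refine Subtype.ext (MultilinearMap.ext fun v => ?_)
    rw [Subsingleton.elim v ![]]
    exact h'
  · intro x
    obtain ⟨f, rfl⟩ := Ext.mk₀_bijective _ _ |>.2 x
    obtain ⟨m, hm, rfl⟩ := exists_trivialHom_eq f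
    exact ⟨⟨MultilinearMap.constOfIsEmpty k _ m, (mem_hochschildCocycles_zero _).2
      ((adAction_eq_counit_smul_iff m).1 hm)⟩, rfl⟩

theorem cocycleZeroToExt_naturality {f : M →ₗ[k] N} (hf : IsBimoduleHom A f)
    (c : hochschildCocycles k A M 0) (c' : hochschildCocycles k A N 0)
    (h : f.compMultilinearMap c.1 = c'.1) :
    (cocycleZeroToExt k A M c).comp (Ext.mk₀ (adMap hf)) (add_zero 0) =
      cocycleZeroToExt k A N c' := by
  refine (Ext.mk₀_comp_mk₀ _ _).trans (congrArg Ext.mk₀ (trivialHom_ext ?_))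
  rw [ModuleCat.hom_comp, LinearMap.comp_apply, trivialHom_trivialOne, trivialHom_trivialOne, ← h]
  rfl

theorem compMultilinearMap_mem_hochschildCocycles {f : M →ₗ[k] N} (hf : IsBimoduleHom A f)
    {n : ℕ} {c : HochschildCochain k A M n} (hc : c ∈ hochschildCocycles k A M n) :
    f.compMultilinearMap c ∈ hochschildCocycles k A N n := by
  change hochschildCoboundary k A N n _ = 0
  rw [hochschildCoboundary_comp hf, LinearMap.mem_ker.1 hc]
  simp

theorem hochschildCoboundaries_zero_submoduleOf :
    (hochschildCoboundaries k A M 0).submoduleOf (hochschildCocycles k A M 0) = ⊥ := by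
  change Submodule.comap _ ⊥ = ⊥
  rw [Submodule.comap_bot, Submodule.ker_subtype]

variable (k A M) in
/-- Hochschild cohomology is the cohomology of the adjoint module. -/
theorem hochschildCohomology_equiv_ext (n : ℕ) :
    Nonempty (HochschildCohomology k A M n ≃ₗ[k]
      Ext (trivialLeft k A) (adModule k A M) n) := by
  induction n generalizing M with
  | zero =>
    exact ⟨Submodule.quotEquivOfEqBot _ hochschildCoboundaries_zero_submoduleOf ≪≫ₗ
      LinearEquiv.ofBijective _ bijective_cocycleZeroToExt⟩
  | succ n ih =>
    have hC : ∀ i, Subsingleton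
        (Ext (trivialLeft k A) (adModule k A (Coind k A M)) (i + 1)) :=
      fun i => Ext.subsingleton_of_injective _ _ i
    have hπ := CoindQuotient.isBimoduleHom_proj (k := k) (A := A) (M := M)
    obtain ⟨e⟩ := hochschildCohomology_succ_equiv Coind.isBimoduleHom_unit hπ
      Coind.unit_injective CoindQuotient.proj_surjective CoindQuotient.exact_unit_proj n
      (exists_hochschildCoboundary_eq_of_coind (k := k) (A := A) (M := M) n)
    have hS := adShortComplex_shortExact Coind.isBimoduleHom_unit hπ
      Coind.unit_injective CoindQuotient.proj_surjective CoindQuotient.exact_unit_proj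
    have : Subsingleton (Ext (trivialLeft k A) (adShortComplex Coind.isBimoduleHom_unit hπ
      CoindQuotient.exact_unit_proj).X₂ (n + 1)) := hC n
    obtain ⟨e'⟩ := ext_succ_equiv_cokernel k (trivialLeft k A) hS n
    cases n with
    -- Degree-zero groups of the coinduced bimodule need not vanish, so here the two cokernels are
    -- matched through naturality of the degree-zero isomorphism.
    | zero =>
      refine ⟨e ≪≫ₗ Submodule.Quotient.equiv _ _
        (LinearEquiv.ofBijective _ bijective_cocycleZeroToExt) ?_ ≪≫ₗ e'.symm⟩
      ext x
      constructor
      · rintro ⟨c, hc, rfl⟩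
        obtain ⟨p, hp, q, ⟨z, hz, rfl⟩, hpq⟩ := Submodule.mem_sup.1 hc
        obtain rfl := (Submodule.mem_bot k).1 hp
        exact ⟨cocycleZeroToExt k A _ ⟨z, hz⟩,
          cocycleZeroToExt_naturality hπ ⟨z, hz⟩ c ((zero_add _).symm.trans hpq)⟩
      · rintro ⟨y, rfl⟩
        obtain ⟨z, rfl⟩ := bijective_cocycleZeroToExt.2 y
        refine ⟨⟨_, compMultilinearMap_mem_hochschildCocycles hπ z.2⟩,
          Submodule.mem_sup_right ⟨z.1, z.2, rfl⟩, ?_⟩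
        exact (cocycleZeroToExt_naturality hπ z _ rfl).symm
    | succ n =>
      obtain ⟨e''⟩ := ih (M := CoindQuotient k A M)
      -- In positive degree the cocycles coming from the coinduced bimodule are coboundaries, so the
      -- cokernel is the full cohomology of the quotient bimodule.
      have h1 : hochschildCoboundaries k A (CoindQuotient k A M) (n + 1) ⊔
          (hochschildCocycles k A (Coind k A M) (n + 1)).map
            ((CoindQuotient.proj k A M).compMultilinearMapₗ k (M₁ := fun _ : Fin (n + 1) => A)) =
          hochschildCoboundaries k A (CoindQuotient k A M) (n + 1) := by
        refine sup_eq_left.2 (Submodule.map_le_iff_le_comap.2 fun c hc => ?_)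
        obtain ⟨b, rfl⟩ := exists_hochschildCoboundary_eq_of_coind n c hc
        exact ⟨_, hochschildCoboundary_comp hπ n b⟩
      rw [h1] at e
      have h2 : LinearMap.range ((Ext.mk₀ (adShortComplex Coind.isBimoduleHom_unit hπ
          CoindQuotient.exact_unit_proj).g).postcompOfLinear k (trivialLeft k A)
            (add_zero (n + 1))) = ⊥ := by
        have := hC n
        rw [LinearMap.range_eq_bot]
        exact LinearMap.ext fun x => by rw [Subsingleton.elim x 0, map_zero, map_zero]
      exact ⟨e ≪≫ₗ e'' ≪≫ₗ (Submodule.quotEquivOfEqBot _ h2).symm ≪≫ₗ e'.symm⟩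

end Cohomology

/-! ### Comparing adjoint relations with twisted commutators -/

section TwistRelations

open HopfAlgebra Coalgebra

variable {k A : Type u} [Field k] [Ring A] [HopfAlgebra k A]
variable {M N : Type u}
  [AddCommGroup M] [Module k M] [Module A M] [Module Aᵐᵒᵖ M]
  [SMulCommClass A Aᵐᵒᵖ M] [IsScalarTower k A M] [IsScalarTower k Aᵐᵒᵖ M]
  [AddCommGroup N] [Module k N] [Module A N] [Module Aᵐᵒᵖ N]
  [SMulCommClass A Aᵐᵒᵖ N] [IsScalarTower k A N] [IsScalarTower k Aᵐᵒᵖ N]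

variable (M) in
/-- The submodule of `M` spanned by the elements `m a - σ(a) m`. -/
def commutatorRelations (σ : A ≃ₐ[k] A) : Submodule k M :=
  Submodule.span k {x | ∃ (a : A) (m : M), x = MulOpposite.op a • m - σ a • m}

theorem sub_mem_commutatorRelations (σ : A ≃ₐ[k] A) (a : A) (m : M) :
    MulOpposite.op a • m - σ a • m ∈ commutatorRelations M σ :=
  Submodule.subset_span ⟨a, m, rfl⟩

theorem adAction_eq_counit_indTwist (a : A) (m : M) :
    adAction k A M a m = Ind.counit k A M (indTwist M (antipode k) (Ind.mk k A M a m)) := by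
  rw [adAction_apply a m (Repr.arbitrary k a), indTwist_mk _ _ _ (Repr.arbitrary k a), map_sum]
  rfl

variable (π : A →ₐ[k] k)

/-- This is `∑ π(a₁) S(a₂) a₃ = ∑ π(a₁) ε(a₂) = π(a)`. -/
theorem sum_antipode_leftWinding_mul (a : A) (r : Repr k a (A × A)) :
    ∑ i ∈ r.index, antipode k (leftWinding π (r.left i)) * r.right i = algebraMap k A (π a) := by
  let l := fun i => Repr.arbitrary k (r.left i)
  have key := congrArg ((TensorProduct.lid k A).toLinearMap ∘ₗ π.toLinearMap.rTensor A)
    (sum_tmul_mul_eq_of_convolution (antipode k) LinearMap.id mul_map_antipode_id a)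
  rw [← sum_comul_tmul_eq r l] at key
  simp only [map_sum, LinearMap.lTensor_tmul, LinearMap.comp_apply, TensorProduct.map_tmul,
    LinearMap.mul'_apply, LinearMap.rTensor_tmul, LinearEquiv.coe_coe, TensorProduct.lid_tmul,
    LinearMap.id_apply, AlgHom.toLinearMap_apply, ← Algebra.algebraMap_eq_smul_one] at key
  rw [← key]
  refine Finset.sum_congr rfl fun i _ => ?_
  change antipode k (leftWindingHom π (r.left i)) * _ = _
  rw [leftWindingHom_repr π (l i)]
  simp only [map_sum, map_smul, Finset.sum_mul, smul_mul_assoc]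

variable {σ : A ≃ₐ[k] A}
  (hσ : ∀ a, antipode k (antipode k (leftWinding π (σ a))) = a)

-- With `ξ` the winding automorphism, `S²ξ` is multiplicative, is injective by `hσ`, and undoes `σ`.
-- Applied to the left side it gives `∑ S(a₂) S²(ξ(a₁)) = S(∑ S(ξ(a₁)) a₂)`, which the preceding
-- identity evaluates.
include hσ in
theorem sum_apply_antipode_mul (a : A) (r : Repr k a (A × A)) :
    ∑ i ∈ r.index, σ (antipode k (r.right i)) * r.left i = algebraMap k A (π a) := by
  have hinj : ∀ x y : A, antipode k (antipode k (leftWinding π x)) =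
      antipode k (antipode k (leftWinding π y)) → x = y := fun x y h => by
    rw [← σ.apply_symm_apply x, ← σ.apply_symm_apply y, hσ, hσ] at h
    rw [← σ.apply_symm_apply x, h, σ.apply_symm_apply]
  apply hinj
  have h := congrArg (antipode k) (sum_antipode_leftWinding_mul π a r)
  simp only [map_sum, antipode_mul_antidistrib, antipode_algebraMap] at h
  simp only [map_sum, map_mul, antipode_mul_antidistrib, AlgEquiv.commutes, antipode_algebraMap, hσ]
  exact h

-- Writing `π(a) m = ∑ σ(S(a₂)) a₁ m` turns `a · m - π(a) m` into the sum of the twisted commutators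
-- of `S(a₂)` with `a₁ m`.
include hσ in
theorem characterRelations_ad_le :
    characterRelations π (Ad k A M) ≤ (commutatorRelations M σ).map (Ad.of k A M).toLinearMap := by
  refine Submodule.span_le.2 ?_
  rintro _ ⟨a, m, rfl⟩
  obtain ⟨m, rfl⟩ := (Ad.of k A M).surjective m
  refine ⟨adAction k A M a m - π a • m, ?_, rfl⟩
  let r := Repr.arbitrary k a
  have h1 : π a • m = ∑ i ∈ r.index, σ (antipode k (r.right i)) • r.left i • m := by
    simp only [smul_smul, ← Finset.sum_smul]
    rw [sum_apply_antipode_mul π hσ a r, algebraMap_smul]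
  rw [adAction_apply a m r, h1, ← Finset.sum_sub_distrib]
  refine Submodule.sum_mem _ fun i _ => ?_
  rw [smul_comm]
  exact sub_mem_commutatorRelations σ _ _

-- Put `x = σ(a)`. Untwisting the induced bimodule gives `x m = ∑ x₁ · (m S²(x₂))` for the adjoint
-- action, while `hσ` gives `m a = ∑ π(x₁) m S²(x₂)`. The difference is a sum of relations for `x₁`
-- and `m S²(x₂)`.
include hσ in
theorem commutatorRelations_le :
    (commutatorRelations M σ).map (Ad.of k A M).toLinearMap ≤ characterRelations π (Ad k A M) := by
  refine Submodule.map_le_iff_le_comap.2 (Submodule.span_le.2 ?_)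
  rintro _ ⟨a, m, rfl⟩
  change Ad.of k A M (MulOpposite.op a • m - σ a • m) ∈ characterRelations π (Ad k A M)
  let r := Repr.arbitrary k (σ a)
  have h1 : σ a • m = ∑ i ∈ r.index, adAction k A M (r.left i)
      (MulOpposite.op (antipode k (antipode k (r.right i))) • m) := by
    have := congrArg (Ind.counit k A M) (indTwist_antipode_indTwist (Ind.mk k A M (σ a) m))
    rw [indTwist_mk _ _ _ r, map_sum, map_sum] at this
    simp only [adAction_eq_counit_indTwist]
    exact this.symm
  have h2 : MulOpposite.op a • m = ∑ i ∈ r.index, π (r.left i) •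
      MulOpposite.op (antipode k (antipode k (r.right i))) • m := by
    conv_lhs => rw [← hσ a]
    change MulOpposite.op (antipode k (antipode k (leftWindingHom π (σ a)))) • m = _
    rw [leftWindingHom_repr π r]
    change (rightMul k A M).flip m _ = _
    simp only [map_sum, map_smul]
    rfl
  rw [h1, h2, ← neg_sub, map_neg, ← Finset.sum_sub_distrib, map_sum]
  refine neg_mem (Submodule.sum_mem _ fun i _ => ?_)
  exact sub_mem_characterRelations π (r.left i)
    (Ad.of k A M (MulOpposite.op (antipode k (antipode k (r.right i))) • m))

include hσ in
theorem map_commutatorRelations :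
    (commutatorRelations M σ).map (Ad.of k A M).toLinearMap = characterRelations π (Ad k A M) :=
  le_antisymm (commutatorRelations_le π hσ) (characterRelations_ad_le π hσ)

end TwistRelations

/-! ### Twisted Hochschild homology in degree zero -/

section Homology

variable {k A : Type u} [Field k] [Ring A] [HopfAlgebra k A]
variable {M N : Type u}
  [AddCommGroup M] [Module k M] [Module A M] [Module Aᵐᵒᵖ M]
  [SMulCommClass A Aᵐᵒᵖ M] [IsScalarTower k A M] [IsScalarTower k Aᵐᵒᵖ M]
  [AddCommGroup N] [Module k N] [Module A N] [Module Aᵐᵒᵖ N]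
  [SMulCommClass A Aᵐᵒᵖ N] [IsScalarTower k A N] [IsScalarTower k Aᵐᵒᵖ N]

variable (σ : A ≃ₐ[k] A)

variable (k A M) in
/-- The zeroth chains with values in `M` are the elements of `M`. -/
def chainZeroEquiv : HochschildChain k A M 0 ≃ₗ[k] M :=
  (PiTensorProduct.isEmptyEquiv (R := k) (Fin 0) (s := fun _ => A)).lTensor M ≪≫ₗ
    TensorProduct.rid k M

@[simp] theorem chainZeroEquiv_tmul (m : M) (v : Fin 0 → A) :
    chainZeroEquiv k A M (m ⊗ₜ PiTensorProduct.tprod k v) = m := by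
  simp [chainZeroEquiv]

theorem map_chainZeroEquiv_boundaries :
    (hochschildBoundaries k A (Twist σ M) 0).map
      ((chainZeroEquiv k A (Twist σ M)) ≪≫ₗ (Twist.of σ M).symm).toLinearMap =
        commutatorRelations M σ := by
  apply le_antisymm
  · rw [hochschildBoundaries, ← LinearMap.range_comp]
    rintro _ ⟨c, rfl⟩
    induction c using TensorProduct.induction_on with
    | zero => simp
    | add s t hs ht => rw [map_add]; exact add_mem hs ht
    | tmul m t =>
      obtain ⟨m, rfl⟩ := (Twist.of (k := k) σ M).surjective m
      induction t using PiTensorProduct.induction_on with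
      | smul_tprod c v =>
        rw [TensorProduct.tmul_smul, map_smul]
        refine Submodule.smul_mem _ _ ?_
        rw [LinearMap.comp_apply, hochschildBoundary_zero_tmul]
        simp [Twist.smul_of, Twist.op_smul_of, ← map_sub]
        exact sub_mem_commutatorRelations σ (v 0) m
      | add s t hs ht => rw [TensorProduct.tmul_add, map_add]; exact add_mem hs ht
  · refine Submodule.span_le.2 ?_
    rintro _ ⟨a, m, rfl⟩
    refine ⟨_, ⟨Twist.of (k := k) σ M m ⊗ₜ PiTensorProduct.tprod k ![a], rfl⟩, ?_⟩
    rw [hochschildBoundary_zero_tmul]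
    simp [Twist.smul_of, Twist.op_smul_of]

end Homology

/-! ### Twisted Hochschild homology as extensions in complementary degree -/

section HomologyExt

variable {k A : Type u} [Field k] [Ring A] [HopfAlgebra k A]
variable {M N : Type u}
  [AddCommGroup M] [Module k M] [Module A M] [Module Aᵐᵒᵖ M]
  [SMulCommClass A Aᵐᵒᵖ M] [IsScalarTower k A M] [IsScalarTower k Aᵐᵒᵖ M]
  [AddCommGroup N] [Module k N] [Module A N] [Module Aᵐᵒᵖ N]
  [SMulCommClass A Aᵐᵒᵖ N] [IsScalarTower k A N] [IsScalarTower k Aᵐᵒᵖ N]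

variable (π : A →ₐ[k] k) (σ : A ≃ₐ[k] A)
  {X : ModuleCat.{u} A} {d : ℕ} {e : Ext X (ModuleCat.of A A) d}
  (he : ∀ a : A, e.comp (Ext.mk₀ (rightMulHom a)) (add_zero d) = π a • e)

variable (M) in
/-- Zeroth Hochschild chains define classes in the top extension group. -/
def chainZeroToExt : HochschildChain k A (Twist σ M) 0 →ₗ[k] Ext X (adModule k A M) d :=
  topExtMap π (Ad k A M) he ∘ₗ
    (chainZeroEquiv k A (Twist σ M) ≪≫ₗ (Twist.of σ M).symm ≪≫ₗ Ad.of k A M).toLinearMap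

theorem chainZeroToExt_naturality {f : M →ₗ[k] N} (hf : IsBimoduleHom A f)
    (c : HochschildChain k A (Twist σ M) 0) :
    (chainZeroToExt M π σ he c).comp (Ext.mk₀ (adMap hf)) (add_zero d) =
      chainZeroToExt N π σ he (chainMap A (twistMap σ f) 0 c) := by
  refine (topExtMap_naturality π he (adLinearMap hf) _).trans (congrArg (topExtMap π _ he) ?_)
  change Ad.of k A N (f ((Twist.of σ M).symm (chainZeroEquiv k A (Twist σ M) c))) =
    Ad.of k A N ((Twist.of σ N).symm (chainZeroEquiv k A (Twist σ N) _))
  congr 1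
  rw [← LinearEquiv.symm_apply_eq, LinearEquiv.symm_symm]
  change twistMap σ f (chainZeroEquiv k A (Twist σ M) c) = _
  refine LinearMap.congr_fun (f := twistMap σ f ∘ₗ (chainZeroEquiv k A (Twist σ M)).toLinearMap)
    (g := (chainZeroEquiv k A (Twist σ N)).toLinearMap ∘ₗ chainMap A (twistMap σ f) 0) ?_ c
  refine TensorProduct.ext (LinearMap.ext fun m => PiTensorProduct.ext
    (MultilinearMap.ext fun v => ?_))
  simp [chainMap]

variable (hspan : ∀ x : Ext X (ModuleCat.of A A) d, ∃ c : k, x = c • e) (he0 : e ≠ 0)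
  [IsNoetherianRing A] [Module.Finite A X] [HasProjectiveDimensionLT X (d + 1)]
  (hσ : ∀ a, HopfAlgebra.antipode k (HopfAlgebra.antipode k (leftWinding π (σ a))) = a)

variable (M) in
include hspan in
theorem chainZeroToExt_surjective : Function.Surjective (chainZeroToExt M π σ he) :=
  (topExtMap_surjective π (Ad k A M) he hspan).comp (LinearEquiv.surjective _)

-- The kernel consists of the relations of the character on `ad M`, which coincide with the
-- `σ`-commutators, that is, with the degree-zero boundaries.
variable (M) in
include hspan he0 hσ in
theorem ker_chainZeroToExt :
    LinearMap.ker (chainZeroToExt M π σ he) = hochschildBoundaries k A (Twist σ M) 0 := by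
  rw [chainZeroToExt, LinearMap.ker_comp, ker_topExtMap π _ he hspan he0,
    ← map_commutatorRelations π hσ, ← map_chainZeroEquiv_boundaries, ← Submodule.map_comp]
  exact Submodule.comap_map_eq_of_injective (LinearEquiv.injective _) _

include he hspan he0 hσ in
/-- Hochschild homology with twisted coefficients is the extension group, in complementary degree,
from a module with one-dimensional top cohomology to the adjoint module. -/
theorem hochschildHomology_equiv_ext
    (hX : ∀ i, i ≠ d → Subsingleton (Ext X (ModuleCat.of A A) i)) (j i : ℕ) (hji : j + i = d) :
    Nonempty (HochschildHomology k A (Twist σ M) j ≃ₗ[k] Ext X (adModule k A M) i) := by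
  induction j generalizing M i with
  | zero =>
    obtain rfl : i = d := by omega
    refine ⟨?_ ≪≫ₗ (chainZeroToExt M π σ he).quotKerEquivOfSurjective
      (chainZeroToExt_surjective M π σ he hspan)⟩
    refine Submodule.Quotient.equiv _ _ Submodule.topEquiv ?_
    rw [ker_chainZeroToExt M π σ he hspan he0 hσ]
    ext x
    exact ⟨fun ⟨y, hy, hyx⟩ => hyx ▸ hy, fun hx => ⟨⟨x, trivial⟩, hx, rfl⟩⟩
  | succ j ih =>
    have hι := IndKernel.isBimoduleHom_incl (k := k) (A := A) (M := M)
    have hε := Ind.isBimoduleHom_counit (k := k) (A := A) (M := M)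
    have hS := adShortComplex_shortExact hι hε IndKernel.incl_injective
      Ind.counit_surjective IndKernel.exact_incl_counit
    have hι' : Function.Injective (twistMap σ (IndKernel.incl k A M)) := IndKernel.incl_injective
    have hε' : Function.Surjective (twistMap σ (Ind.counit k A M)) :=
      Ind.counit_surjective (k := k) (A := A) (M := M)
    have hιε : Function.Exact (twistMap σ (IndKernel.incl k A M))
      (twistMap σ (Ind.counit k A M)) :=
      IndKernel.exact_incl_counit (k := k) (A := A) (M := M)
    obtain ⟨e₁⟩ := hochschildHomology_succ_equiv (isBimoduleHom_twistMap σ hι)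
      (isBimoduleHom_twistMap σ hε) hι' hε' hιε j
      (exists_hochschildBoundary_eq_of_twist_ind (k := k) (A := A) (M := M) σ j)
    -- The adjoint module of an induced bimodule is free, so it inherits the vanishing outside
    -- degree `d` from `A`.
    have hF (l : ℕ) (hl : l ≠ d) : Subsingleton (Ext X (adModule k A (Ind k A M)) l) := by
      have := hX l hl
      exact subsingleton_ext_of_free X l _
    have : Subsingleton (Ext X (adShortComplex hι hε IndKernel.exact_incl_counit).X₂ i) :=
      hF i (by omega)
    obtain ⟨e₂⟩ := ext_equiv_ker k X hS i
    suffices Nonempty (_ ≃ₗ[k] LinearMap.ker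
        ((Ext.mk₀ (adMap hι)).postcompOfLinear k X (add_zero (i + 1)))) from
      this.elim fun e₃ => ⟨e₁ ≪≫ₗ e₃ ≪≫ₗ e₂.symm⟩
    cases j with
    | zero =>
      -- The shift lands in the top degree, where the middle `Ext` need not vanish; the two kernels
      -- are compared through `chainZeroToExt`.
      obtain rfl : i + 1 = d := by omega
      have hW : (hochschildBoundaries k A (Twist σ (Ind k A M)) 0).comap
          (chainMap A (twistMap σ (IndKernel.incl k A M)) 0) =
          (LinearMap.ker ((Ext.mk₀ (adMap hι)).postcompOfLinear k X (add_zero (i + 1)))).comap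
            (chainZeroToExt (IndKernel k A M) π σ he) := by
        rw [← ker_chainZeroToExt _ π σ he hspan he0 hσ]
        ext c
        exact Eq.congr_left (chainZeroToExt_naturality π σ he hι c).symm
      rw [hW, ← ker_chainZeroToExt _ π σ he hspan he0 hσ]
      let K := LinearMap.ker ((Ext.mk₀ (adMap hι)).postcompOfLinear k X (add_zero (i + 1)))
      let g : K.comap (chainZeroToExt (IndKernel k A M) π σ he) →ₗ[k] K :=
        (chainZeroToExt (IndKernel k A M) π σ he).restrict fun c hc => hc
      refine ⟨Submodule.quotEquivOfEq _ (LinearMap.ker g) ?_ ≪≫ₗ g.quotKerEquivOfSurjective ?_⟩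
      · ext c
        exact ⟨fun h => Subtype.ext h, fun h => congrArg Subtype.val h⟩
      · rintro ⟨y, hy⟩
        obtain ⟨c, rfl⟩ := chainZeroToExt_surjective (IndKernel k A M) π σ he hspan y
        exact ⟨⟨c, hy⟩, rfl⟩
    | succ j =>
      obtain ⟨e₃⟩ := ih (M := IndKernel k A M) (i + 1) (by omega)
      have hW : (hochschildBoundaries k A (Twist σ (Ind k A M)) (j + 1)).comap
          (chainMap A (twistMap σ (IndKernel.incl k A M)) (j + 1)) =
          hochschildCycles k A (Twist σ (IndKernel k A M)) (j + 1) := by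
        ext c
        constructor
        · rintro ⟨b, hb⟩
          exact mem_hochschildCycles_of_chainMap (isBimoduleHom_twistMap σ hι) hι'
            (hb ▸ hochschildBoundary_mem_cycles (j + 1) b)
        · intro hc
          refine exists_hochschildBoundary_eq_of_twist_ind σ j _ ?_
          exact chainMap_mem_hochschildCycles (isBimoduleHom_twistMap σ hι) hc
      -- Now `i + 1 < d`, so the target vanishes and the kernel is the whole extension group.
      have hker : LinearMap.ker ((Ext.mk₀ (adMap hι)).postcompOfLinear k X
          (add_zero (i + 1))) = ⊤ := by
        have := hF (i + 1) (by omega)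
        exact LinearMap.ker_eq_top.2 (LinearMap.ext fun x => Subsingleton.elim _ _)
      rw [hW]
      exact ⟨e₃ ≪≫ₗ Submodule.topEquiv.symm ≪≫ₗ LinearEquiv.ofEq _ _ hker.symm⟩

end HomologyExt

theorem hasProjectiveDimensionLT_of_globalDimension_eq {A : Type u} [Ring A] {d : ℕ}
    (h : globalDimension A = (d : WithBot ℕ∞)) (X : ModuleCat.{u} A) :
    HasProjectiveDimensionLT X (d + 1) :=
  (projectiveDimension_le_iff X d).1
    ((le_iSup (fun Y : ModuleCat.{u} A => projectiveDimension Y) X).trans_eq h)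

end

end HopfDuality

/-! ### The duality isomorphism -/

theorem corollary5p2 {k A : Type u} [Field k] [Ring A] [HopfAlgebra k A]
    [IsNoetherianRing A] [IsNoetherianRing Aᵐᵒᵖ]
    (hS : Function.Bijective (HopfAlgebra.antipode k : A →ₗ[k] A))
    (d : ℕ) (hA : HopfDuality.IsASRegular k A d)
    (M : Type u) [AddCommGroup M] [Module k M] [Module A M] [Module Aᵐᵒᵖ M]
    [SMulCommClass A Aᵐᵒᵖ M] [IsScalarTower k A M] [IsScalarTower k Aᵐᵒᵖ M]
    (i : ℕ) (hi : i ≤ d) :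
    Nonempty (HopfDuality.HochschildCohomology k A M i ≃ₗ[k]
      HopfDuality.HochschildHomology k A
        (HopfDuality.Twist
          ((HopfDuality.antipodeSq hS).symm.trans
            (HopfDuality.leftWinding
              (HopfDuality.integralCharacter hA.finrank_ext_left)).symm) M) (d - i)) := by
  obtain ⟨e, he0, hspan⟩ := finrank_eq_one_iff'.1 hA.finrank_ext_left
  have := HopfDuality.hasProjectiveDimensionLT_of_globalDimension_eq hA.globalDimension_eq
    (HopfDuality.trivialLeft k A)
  obtain ⟨f⟩ := HopfDuality.hochschildCohomology_equiv_ext (k := k) (A := A) (M := M) i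
  obtain ⟨g⟩ := HopfDuality.hochschildHomology_equiv_ext (M := M)
    (HopfDuality.integralCharacter hA.finrank_ext_left)
    ((HopfDuality.antipodeSq hS).symm.trans
      (HopfDuality.leftWinding (HopfDuality.integralCharacter hA.finrank_ext_left)).symm)
    (fun a => HopfDuality.integralRightAct_eq_smul hA.finrank_ext_left a e)
    (fun x => (hspan x).imp fun _ hc => hc.symm) he0
    -- For `σ = ξ⁻¹ S⁻²` the required identity `S²(ξ(σ(a))) = a` holds by cancellation.
    (fun a => by
      rw [AlgEquiv.trans_apply, AlgEquiv.apply_symm_apply]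
      exact (HopfDuality.antipodeSq hS).apply_symm_apply a)
    hA.subsingleton_ext_left (d - i) i (Nat.sub_add_cancel hi)
  exact ⟨f ≪≫ₗ g.symm⟩
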